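/- Let $p>3$ be a prime and let $$M_1=\langle\rho,\sigma,\tau\mid\rho^p=\sigma^p=\tau^p=1,\ \sigma\rho=\rho\sigma,\ \tau\rho=\rho\tau,\ \tau\sigma=\rho\sigma\tau\rangle$$ be the Heisenberg group of order $p^3$. A skew brace $(B,\oplus,\odot)$ is a set with two group structures such that $a\odot(b\oplus c)=(a\odot b)\ominus a\oplus(a\odot c)$ for all $a,b,c$. It is of $M_1$ type if $(B,\oplus)\cong M_1$, and trivial if $\oplus=\odot$. Let $\lambda:(B,\odot)\to\mathrm{Aut}(B,\oplus)$, $\lambda_a(b)=\ominus a\oplus(a\odot b)$. Put $$\mathrm{Soc}(B)=\{a\in B\mid a\oplus b=a\odot b,\ b\oplus(b\odot a)=(b\odot a)\oplus b\ \text{for all } b\in B\},\qquad \mathrm{Ann}(B)=\mathrm{Soc}(B)\cap Z(B,\odot).$$ An annihilator extension is a short exact sequence $A\to E\to Q$ of skew braces in which the image of $A$ is contained in $\mathrm{Ann}(E)$. Let $B$ be a skew brace of $M_1$ type. 1. If $B$ is not trivial, then $|\ker\lambda|\in\{p^2,p,1\}$. 2. If $|\ker\lambda|$ is $p^2$ or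 $p$, then $\mathrm{Soc}(B)=\mathrm{Ann}(B)=Z(B,\oplus)$, and every isomorphism $(B,\oplus)\to M_1$ maps this set onto $\langle\rho\rangle=Z(M_1)$. 3. If $|\ker\lambda|=1$, then $\mathrm{Soc}(B)=\mathrm{Ann}(B)$ consists of the identity only. Consequently $B$ is not the middle term of any annihilator extension $A\to B\to Q$ with $A$ non-zero. 4. Up to isomorphism there are exactly four skew braces of $M_1$ type with $|\ker\lambda|=1$. Namely, let $\alpha_1,\alpha_2,\alpha_3\in\mathrm{Aut}(M_1)$ be given by $$\alpha_1:\sigma\mapsto\rho\sigma,\ \tau\mapsto\tau;\qquad \alpha_2:\sigma\mapsto\sigma\tau,\ \tau\mapsto\tau;\qquad \alpha_3:\sigma\mapsto\sigma,\ \tau\mapsto\rho\tau,$$ and let $\delta\in\mathbb F_p$ be any fixed non-square. For $s\in\{1,\delta\}$ and $t\in\{0,1\}$ the subgroup $$H_{s,t}=\langle\tau^{-2}\alpha_1,\ \rho^{s}\tau\alpha_2,\ \sigma^{2}\tau^{t}\alpha_3\rangle$$ of the holomorph $\mathrm{Hol}(M_1)=M_1\rtimes\mathrm{Aut}(M_1)$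 is regular on $M_1$. Make $H_{s,t}$ a skew brace in which $\odot$ is the group operation of $H_{s,t}$ and $\oplus$ is carried over from $M_1$ by the bijection $h\mapsto h(1)$. Then $H_{s,t}$ is of $M_1$ type, $(H_{s,t},\odot)\cong M_1$, and $|\ker\lambda|=1$. Every skew brace of $M_1$ type with $|\ker\lambda|=1$ is isomorphic to $H_{s,t}$ for exactly one pair $(s,t)$. -/

import Mathlib

/-! ### Skew braces -/

/-- A skew (left) brace: two group structures `(B, +)` (not necessarily abelian) and `(B, *)`
with `a * (b + c) = a * b - a + a * c`. -/
class SkewBrace (B : Type*) extends AddGroup B, Group B where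
  brace : ∀ a b c : B, a * (b + c) = a * b + -a + a * c

namespace SkewBrace

variable {B : Type*} [SkewBrace B]

theorem mul_zero_eq (a : B) : a * (0 : B) = a := by
  have h := brace a 0 0
  rw [add_zero, add_assoc] at h
  have h2 : -a + a * (0 : B) = 0 := by
    have h3 : a * (0 : B) + (-a + a * 0) = a * (0 : B) + 0 := by rw [← h, add_zero]
    exact add_left_cancel h3
  rw [neg_add_eq_zero] at h2
  exact h2.symm

theorem one_eq_zero : (1 : B) = 0 := by
  have h := mul_zero_eq (1 : B)
  rw [one_mul] at h
  exact h.symm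

theorem lam_mul (a b c : B) : -(a * b) + a * b * c = -a + a * (-b + b * c) := by
  have h := brace a b (-b + b * c)
  rw [add_neg_cancel_left, ← mul_assoc] at h
  rw [h]
  simp only [add_assoc, neg_add_cancel_left]

/-- The homomorphism `λ : (B, *) → Aut (B, +)`, `λ_a (b) = -a + a * b`; the additive group of `B`
is written as `Multiplicative B`. -/
def lam (B : Type*) [SkewBrace B] : B →* MulAut (Multiplicative B) where
  toFun a :=
    { toFun := fun b => Multiplicative.ofAdd (-a + a * b.toAdd)
      invFun := fun b => Multiplicative.ofAdd (-a⁻¹ + a⁻¹ * b.toAdd)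
      left_inv := fun b => by
        change -a⁻¹ + a⁻¹ * (-a + a * b.toAdd) = b.toAdd
        rw [← lam_mul, inv_mul_cancel, one_mul, one_eq_zero, neg_zero, zero_add]
      right_inv := fun b => by
        change -a + a * (-a⁻¹ + a⁻¹ * b.toAdd) = b.toAdd
        rw [← lam_mul, mul_inv_cancel, one_mul, one_eq_zero, neg_zero, zero_add]
      map_mul' := fun b c => by
        change -a + a * (b.toAdd + c.toAdd) = (-a + a * b.toAdd) + (-a + a * c.toAdd)
        rw [brace]
        simp only [add_assoc] }
  map_one' := by
    ext b
    change -(1 : B) + 1 * b.toAdd = b.toAdd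
    rw [one_mul, one_eq_zero, neg_zero, zero_add]
  map_mul' a b := by
    ext c
    exact lam_mul a b c.toAdd

variable (B)

/-- The trivial skew braces: the two operations coincide. -/
def IsTrivial : Prop := ∀ a b : B, a * b = a + b

/-- The socle of a skew brace. -/
def socle : Set B :=
  {a | ∀ b : B, a + b = a * b ∧ b + b * a = b * a + b}

/-- The annihilator of a skew brace, `Soc B ∩ Z (B, *)`. -/
def annihilator : Set B := socle B ∩ (Subgroup.center B : Set B)

/-- `B` is of type `N` if its additive group is isomorphic to `N`. -/
def IsOfType (N : Type*) [Group N] : Prop := Nonempty (Multiplicative B ≃* N)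

variable {B}

/-- A morphism of skew braces: a homomorphism for both operations. -/
structure IsHom {C : Type*} [SkewBrace C] (f : B → C) : Prop where
  map_add : ∀ a b, f (a + b) = f a + f b
  map_mul : ∀ a b, f (a * b) = f a * f b

/-- `A → E → Q` is an annihilator extension: a short exact sequence of skew braces in which the
image of `A` lies in the annihilator of `E`. -/
structure IsAnnihilatorExtension {A E Q : Type*} [SkewBrace A] [SkewBrace E] [SkewBrace Q]
    (i : A → E) (q : E → Q) : Prop where
  hom_left : IsHom i
  hom_right : IsHom q
  injective : Function.Injective i
  surjective : Function.Surjective q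
  exact : Set.range i = {e | q e = 0}
  range_subset : Set.range i ⊆ annihilator E

end SkewBrace

/-! ### The holomorph and the skew brace of a regular subgroup -/

/-- The holomorph `N ⋊ Aut N`; the element `η α` is the pair `⟨η, α⟩`. -/
abbrev Hol (N : Type*) [Group N] : Type _ := N ⋊[MonoidHom.id (MulAut N)] MulAut N

namespace Hol

variable {N : Type*} [Group N]

/-- The action of the holomorph on `N`: the element `η α` sends `n` to `η * α n`. -/
def act (h : Hol N) (n : N) : N := h.left * h.right n

/-- A subgroup of the holomorph is regular if it acts simply transitively on `N`. -/
def IsRegular (H : Subgroup (Hol N)) : Prop :=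
  ∀ x y : N, ∃! h : H, act (h : Hol N) x = y

theorem bijective_of_isRegular {H : Subgroup (Hol N)} (hH : IsRegular H) :
    Function.Bijective (fun h : H => act (h : Hol N) 1) :=
  (Function.bijective_iff_existsUnique _).2 fun y => hH 1 y

/-- The skew brace of a regular subgroup `H` of the holomorph of `N`: it has `H` as its underlying
set and as its multiplicative group. -/
def Brace (H : Subgroup (Hol N)) (_hH : IsRegular H) : Type _ := H

variable {H : Subgroup (Hol N)} {hH : IsRegular H}

namespace Brace

instance : Group (Brace H hH) := inferInstanceAs (Group H)

/-- The bijection `h ↦ h (1)` from `H` to `N`. -/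
noncomputable def psi : Brace H hH ≃ N :=
  Equiv.ofBijective (fun h : H => act (h : Hol N) 1) (bijective_of_isRegular hH)

theorem psi_mul (g h : Brace H hH) : psi (g * h) = act (Subtype.val g) (psi h) := by
  change (Subtype.val g * Subtype.val h).left * (Subtype.val g * Subtype.val h).right 1 =
    (Subtype.val g).left * (Subtype.val g).right ((Subtype.val h).left * (Subtype.val h).right 1)
  simp

/-- The additive operation `g + h = ψ⁻¹ (ψ g * ψ h)`. -/
noncomputable instance : Add (Brace H hH) := ⟨fun g h => psi.symm (psi g * psi h)⟩
noncomputable instance : Zero (Brace H hH) := ⟨psi.symm 1⟩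
noncomputable instance : Neg (Brace H hH) := ⟨fun g => psi.symm (psi g)⁻¹⟩

theorem psi_add (g h : Brace H hH) : psi (g + h) = psi g * psi h :=
  Equiv.apply_symm_apply _ _
theorem psi_zero : psi (0 : Brace H hH) = 1 := Equiv.apply_symm_apply _ _
theorem psi_neg (g : Brace H hH) : psi (-g) = (psi g)⁻¹ := Equiv.apply_symm_apply _ _

noncomputable instance : AddGroup (Brace H hH) :=
  AddGroup.ofLeftAxioms
    (fun a b c => psi.injective (by simp only [psi_add, mul_assoc]))
    (fun a => psi.injective (by simp only [psi_add, psi_zero, one_mul]))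
    (fun a => psi.injective (by simp only [psi_add, psi_neg, psi_zero, inv_mul_cancel]))

noncomputable instance : SkewBrace (Brace H hH) where
  brace a b c := psi.injective (by
    have ha : psi a = (Subtype.val a).left := by
      change (Subtype.val a).left * (Subtype.val a).right 1 = _
      simp
    simp only [psi_add, psi_neg, psi_mul, ha]
    simp [act, mul_assoc])

end Brace

end Hol

/-! ### The Heisenberg group `M₁` and its automorphisms `α₁, α₂, α₃` -/

/-- The underlying set of the Heisenberg group `M₁` of order `p ^ 3`: the triple `⟨a, b, c⟩`
stands for the normal form `ρ ^ a * σ ^ b * τ ^ c`. -/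
@[ext] structure M1 (p : ℕ) where
  r : ZMod p
  s : ZMod p
  t : ZMod p

namespace M1

variable {p : ℕ}

instance : Mul (M1 p) := ⟨fun x y => ⟨x.r + y.r + x.t * y.s, x.s + y.s, x.t + y.t⟩⟩
instance : One (M1 p) := ⟨⟨0, 0, 0⟩⟩
instance : Inv (M1 p) := ⟨fun x => ⟨-x.r + x.t * x.s, -x.s, -x.t⟩⟩

@[simp] theorem mul_r (x y : M1 p) : (x * y).r = x.r + y.r + x.t * y.s := rfl
@[simp] theorem mul_s (x y : M1 p) : (x * y).s = x.s + y.s := rfl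
@[simp] theorem mul_t (x y : M1 p) : (x * y).t = x.t + y.t := rfl
@[simp] theorem one_r : (1 : M1 p).r = 0 := rfl
@[simp] theorem one_s : (1 : M1 p).s = 0 := rfl
@[simp] theorem one_t : (1 : M1 p).t = 0 := rfl
@[simp] theorem inv_r (x : M1 p) : (x⁻¹).r = -x.r + x.t * x.s := rfl
@[simp] theorem inv_s (x : M1 p) : (x⁻¹).s = -x.s := rfl
@[simp] theorem inv_t (x : M1 p) : (x⁻¹).t = -x.t := rfl

instance : Group (M1 p) :=
  Group.ofLeftAxioms (fun x y z => by ext <;> simp <;> ring) (fun x => by ext <;> simp)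
    (fun x => by ext <;> simp)

/-- The generators `ρ`, `σ`, `τ`. -/
def rho : M1 p := ⟨1, 0, 0⟩
def sigma : M1 p := ⟨0, 1, 0⟩
def tau : M1 p := ⟨0, 0, 1⟩

theorem rho_pow (n : ℕ) : (rho : M1 p) ^ n = ⟨n, 0, 0⟩ := by
  induction n with
  | zero => ext <;> simp
  | succ n ih => rw [pow_succ, ih]; ext <;> simp [rho]

theorem sigma_pow (n : ℕ) : (sigma : M1 p) ^ n = ⟨0, n, 0⟩ := by
  induction n with
  | zero => ext <;> simp
  | succ n ih => rw [pow_succ, ih]; ext <;> simp [sigma]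

theorem tau_pow (n : ℕ) : (tau : M1 p) ^ n = ⟨0, 0, n⟩ := by
  induction n with
  | zero => ext <;> simp
  | succ n ih => rw [pow_succ, ih]; ext <;> simp [tau]

/-- The defining relators of `M₁` on generators `ρ, σ, τ` (numbered `0, 1, 2`):
`ρ ^ p`, `σ ^ p`, `τ ^ p`, `σ ρ = ρ σ`, `τ ρ = ρ τ`, `τ σ = ρ σ τ`. -/
def relators (p : ℕ) : Set (FreeGroup (Fin 3)) :=
  let ρ := FreeGroup.of (0 : Fin 3)
  let σ := FreeGroup.of (1 : Fin 3)
  let τ := FreeGroup.of (2 : Fin 3)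
  {ρ ^ p, σ ^ p, τ ^ p, σ * ρ * (ρ * σ)⁻¹, τ * ρ * (ρ * τ)⁻¹, τ * σ * (ρ * σ * τ)⁻¹}

/-- The map from the presented group that sends the generators to `ρ, σ, τ`. -/
def ofPresented (p : ℕ) : PresentedGroup (relators p) →* M1 p :=
  PresentedGroup.toGroup (f := ![rho, sigma, tau]) (by
    intro w hw
    simp only [relators, Set.mem_insert_iff, Set.mem_singleton_iff] at hw
    rcases hw with rfl | rfl | rfl | rfl | rfl | rfl
    · simp only [map_pow, FreeGroup.lift_apply_of]
      change rho ^ p = 1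
      rw [rho_pow]; ext <;> simp
    · simp only [map_pow, FreeGroup.lift_apply_of]
      change sigma ^ p = 1
      rw [sigma_pow]; ext <;> simp
    · simp only [map_pow, FreeGroup.lift_apply_of]
      change tau ^ p = 1
      rw [tau_pow]; ext <;> simp
    all_goals
      simp only [map_mul, map_inv, FreeGroup.lift_apply_of]
      rw [mul_inv_eq_one]
      ext <;> simp [rho, sigma, tau])

/-- `M1 p` is the group presented by the generators `ρ, σ, τ` and the relators above. -/
theorem ofPresented_bijective (p : ℕ) [NeZero p] : Function.Bijective (ofPresented p) := by
  set R : PresentedGroup (relators p) := PresentedGroup.of 0 with hR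
  set S : PresentedGroup (relators p) := PresentedGroup.of 1 with hS
  set T : PresentedGroup (relators p) := PresentedGroup.of 2 with hT
  have one : ∀ w ∈ relators p, PresentedGroup.mk (relators p) w = 1 := fun w hw =>
    PresentedGroup.one_of_mem hw
  have r1 : R ^ p = 1 := by
    have := one (FreeGroup.of 0 ^ p) (by simp [relators]); exact this
  have r2 : S ^ p = 1 := by
    have := one (FreeGroup.of 1 ^ p) (by simp [relators]); exact this
  have r3 : T ^ p = 1 := by
    have := one (FreeGroup.of 2 ^ p) (by simp [relators]); exact this
  have r4 : S * R = R * S := by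
    have := one (FreeGroup.of 1 * FreeGroup.of 0 * (FreeGroup.of 0 * FreeGroup.of 1)⁻¹)
      (by simp [relators])
    rw [map_mul, map_inv, mul_inv_eq_one] at this; exact this
  have r5 : T * R = R * T := by
    have := one (FreeGroup.of 2 * FreeGroup.of 0 * (FreeGroup.of 0 * FreeGroup.of 2)⁻¹)
      (by simp [relators])
    rw [map_mul, map_inv, mul_inv_eq_one] at this; exact this
  have r6 : T * S = R * S * T := by
    have := one (FreeGroup.of 2 * FreeGroup.of 1 *
      (FreeGroup.of 0 * FreeGroup.of 1 * FreeGroup.of 2)⁻¹) (by simp [relators])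
    rw [map_mul, map_inv, mul_inv_eq_one] at this; exact this
  have pS : ∀ n : ℕ, T * S ^ n = R ^ n * S ^ n * T := by
    intro n
    induction n with
    | zero => simp
    | succ n ih =>
      have c : S ^ n * R = R * S ^ n := (Commute.pow_left (show Commute S R from r4) n)
      calc T * S ^ (n + 1) = (T * S ^ n) * S := by rw [pow_succ, mul_assoc]
        _ = R ^ n * S ^ n * (T * S) := by rw [ih, mul_assoc]
        _ = R ^ n * (S ^ n * R) * S * T := by rw [r6]; simp only [mul_assoc]
        _ = _ := by rw [c, pow_succ, pow_succ]; simp only [mul_assoc]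
  have norm : ∀ g : PresentedGroup (relators p), ∃ a b c : ℕ, g = R ^ a * S ^ b * T ^ c := by
    have key : ∀ x : Fin 3, ∀ a b c : ℕ, ∃ a' b' c' : ℕ,
        (PresentedGroup.of x : PresentedGroup (relators p)) * (R ^ a * S ^ b * T ^ c)
          = R ^ a' * S ^ b' * T ^ c' := by
      intro x a b c
      fin_cases x
      · exact ⟨a + 1, b, c, by
          change R * _ = _
          rw [pow_succ']; simp only [mul_assoc]⟩
      · refine ⟨a, b + 1, c, ?_⟩
        change S * _ = _
        have c' : S * R ^ a = R ^ a * S := (Commute.pow_right (show Commute S R from r4) a)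
        rw [← mul_assoc, ← mul_assoc, c', pow_succ']; simp only [mul_assoc]
      · refine ⟨a + b, b, c + 1, ?_⟩
        change T * _ = _
        have c' : T * R ^ a = R ^ a * T := (Commute.pow_right (show Commute T R from r5) a)
        rw [← mul_assoc, ← mul_assoc, c', mul_assoc (R ^ a), pS, pow_succ', pow_add]
        simp only [mul_assoc]
    have keyn : ∀ x : Fin 3, ∀ n a b c : ℕ, ∃ a' b' c' : ℕ,
        (PresentedGroup.of x : PresentedGroup (relators p)) ^ n * (R ^ a * S ^ b * T ^ c)
          = R ^ a' * S ^ b' * T ^ c' := by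
      intro x n
      induction n with
      | zero => intro a b c; exact ⟨a, b, c, by simp⟩
      | succ n ih =>
        intro a b c
        obtain ⟨a', b', c', h⟩ := key x a b c
        rw [pow_succ, mul_assoc, h]
        exact ih _ _ _
    have invp : ∀ x : Fin 3, (PresentedGroup.of x : PresentedGroup (relators p))⁻¹ =
        (PresentedGroup.of x) ^ (p - 1) := by
      intro x
      rw [inv_eq_iff_mul_eq_one, ← pow_succ', Nat.sub_add_cancel (NeZero.one_le)]
      fin_cases x
      · exact r1
      · exact r2
      · exact r3
    intro g
    have hg : g ∈ Subgroup.closure (Set.range (PresentedGroup.of (rels := relators p))) := by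
      rw [PresentedGroup.closure_range_of]; trivial
    induction hg using Subgroup.closure_induction_left with
    | one => exact ⟨0, 0, 0, by simp⟩
    | mul_left x hx y _ ih =>
      obtain ⟨i, rfl⟩ := hx
      obtain ⟨a, b, c, rfl⟩ := ih
      exact key i a b c
    | inv_mul_cancel x hx y _ ih =>
      obtain ⟨i, rfl⟩ := hx
      obtain ⟨a, b, c, rfl⟩ := ih
      rw [invp]
      exact keyn i _ a b c
  have ev : ∀ a b c : ℕ, ofPresented p (R ^ a * S ^ b * T ^ c) = ⟨a, b, c⟩ := by
    intro a b c
    have e0 : ofPresented p R = rho := by simp [ofPresented, hR]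
    have e1 : ofPresented p S = sigma := by simp [ofPresented, hS]
    have e2 : ofPresented p T = tau := by simp [ofPresented, hT]
    rw [map_mul, map_mul, map_pow, map_pow, map_pow, e0, e1, e2, rho_pow, sigma_pow, tau_pow]
    ext <;> simp
  constructor
  · rw [injective_iff_map_eq_one]
    intro g hg
    obtain ⟨a, b, c, rfl⟩ := norm g
    rw [ev, M1.ext_iff] at hg
    obtain ⟨ha, hb, hc⟩ := hg
    simp only [one_r, one_s, one_t, ZMod.natCast_eq_zero_iff] at ha hb hc
    obtain ⟨a, rfl⟩ := ha
    obtain ⟨b, rfl⟩ := hb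
    obtain ⟨c, rfl⟩ := hc
    simp [pow_mul, r1, r2, r3]
  · intro x
    refine ⟨R ^ x.r.val * S ^ x.s.val * T ^ x.t.val, ?_⟩
    rw [ev]
    ext <;> simp

/-- `α₁ : σ ↦ ρ σ, τ ↦ τ`. -/
def alpha1 : MulAut (M1 p) where
  toFun x := ⟨x.r + x.s, x.s, x.t⟩
  invFun x := ⟨x.r - x.s, x.s, x.t⟩
  left_inv x := by ext <;> simp
  right_inv x := by ext <;> simp
  map_mul' x y := by ext <;> simp; ring

/-- `α₃ : σ ↦ σ, τ ↦ ρ τ`. -/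
def alpha3 : MulAut (M1 p) where
  toFun x := ⟨x.r + x.t, x.s, x.t⟩
  invFun x := ⟨x.r - x.t, x.s, x.t⟩
  left_inv x := by ext <;> simp
  right_inv x := by ext <;> simp
  map_mul' x y := by ext <;> simp; ring

/-- `α₂ : σ ↦ σ τ, τ ↦ τ`, for odd `p`; on normal forms,
`ρ ^ a * σ ^ b * τ ^ c ↦ ρ ^ (a + b (b - 1) / 2) * σ ^ b * τ ^ (c + b)`. -/
def alpha2 [Fact p.Prime] (hp : 3 < p) : MulAut (M1 p) where
  toFun x := ⟨x.r + x.s * (x.s - 1) / 2, x.s, x.t + x.s⟩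
  invFun x := ⟨x.r - x.s * (x.s - 1) / 2, x.s, x.t - x.s⟩
  left_inv x := by ext <;> simp
  right_inv x := by ext <;> simp
  map_mul' x y := by
    have h2 : (2 : ZMod p) ≠ 0 := by
      intro h
      have h' : ((2 : ℕ) : ZMod p) = 0 := by exact_mod_cast h
      rw [ZMod.natCast_eq_zero_iff] at h'
      have := Nat.le_of_dvd (by norm_num) h'
      omega
    ext
    · simp
      field_simp
      ring
    · simp
    · simp; ring

/-- The subgroup `⟨τ⁻² α₁, ρ ^ s τ α₂, σ² τ ^ t α₃⟩` of the holomorph of `M₁`. -/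
def kerOneSubgroup [Fact p.Prime] (hp : 3 < p) (s t : ZMod p) : Subgroup (Hol (M1 p)) :=
  Subgroup.closure
    {⟨(tau ^ 2)⁻¹, alpha1⟩, ⟨rho ^ s.val * tau, alpha2 hp⟩, ⟨sigma ^ 2 * tau ^ t.val, alpha3⟩}

end M1

/-!
A `p`-group acting on a group with centre of order `p` fixes that centre pointwise, so every `λ_b`
fixes `Z(B, +)`. If `|ker λ|` is `p` or `p ^ 2`, then `λ` has abelian image, and for central `z` all
differences `λ_z c - c` and their additive conjugates lie in `ker λ`. Were `ker λ ∩ Z(B, +)`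
trivial, class two would make these differences central, hence zero, and `z` itself would lie in
`ker λ`. So `Z(B, +)` is contained in `ker λ`, and socle, annihilator and centre coincide.

If `|ker λ| = 1`, then `λ` embeds `(B, *)` as a Sylow `p`-subgroup of `Aut M₁`. These are conjugate
to the unipotent group generated by the `α_i`, which is again a copy of `M₁`, so `B` is encoded by a
bijective crossed homomorphism `π : M₁ → M₁`. The relations of `M₁` determine `π` on generators: up
to conjugation `π ρ = τ⁻²`, `π σ = ρ ^ s τ`, `π τ = σ² τ ^ t`, with `s ≠ 0` since `π` is injective.
Isomorphic braces are matched by an automorphism of `M₁` which modulo the centre is triangular with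
diagonal entries `a, d`, and this turns `(s, t)` into `(a ^ 2 * s, d / a * t)`. Thus only the square
class of `s` and the vanishing of `t` survive.
-/

section FixedPoints

variable {G N : Type*} [Group G] [Group N] {p : ℕ} [Fact p.Prime]

theorem exists_ne_one_forall_apply_eq_self [Finite N] (hG : IsPGroup p G) (Λ : G →* MulAut N)
    (hN : p ∣ Nat.card N) : ∃ x ≠ 1, ∀ g, Λ g x = x := by
  let _ := MulAction.compHom N Λ
  have one_fixed : (1 : N) ∈ MulAction.fixedPoints G N := fun g => map_one (Λ g)
  obtain ⟨x, hx, x_ne⟩ := hG.exists_fixed_point_of_prime_dvd_card_of_fixed_point N hN one_fixed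
  exact ⟨x, x_ne.symm, hx⟩

theorem apply_eq_self_of_natCard_eq_prime (hG : IsPGroup p G) (Λ : G →* MulAut N)
    (hN : Nat.card N = p) (g : G) (x : N) : Λ g x = x := by
  have : Finite N := Nat.finite_of_card_ne_zero (hN ▸ NeZero.ne p)
  obtain ⟨y, y_ne, hy⟩ := exists_ne_one_forall_apply_eq_self hG Λ hN.symm.dvd
  obtain ⟨k, rfl⟩ := mem_zpowers_of_prime_card hN y_ne (g' := x)
  rw [map_zpow, hy]

theorem apply_eq_self_of_mem_center (hG : IsPGroup p G) (Λ : G →* MulAut N)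
    (hN : Nat.card (Subgroup.center N) = p) (g : G) {z : N} (hz : z ∈ Subgroup.center N) :
    Λ g z = z :=
  congrArg Subtype.val (apply_eq_self_of_natCard_eq_prime hG
    ((MulAut.characteristic (Subgroup.center N)).comp Λ) hN g ⟨z, hz⟩)

/-- The action of the automorphisms of `N` on the quotient by a characteristic subgroup. -/
def mulAutQuotient (K : Subgroup N) [K.Characteristic] : MulAut N →* MulAut (N ⧸ K) where
  toFun e := QuotientGroup.congr K K e (Subgroup.characteristic_iff_map_eq.mp ‹_› e)
  map_one' := by
    ext x
    exact Quotient.inductionOn' x fun _ => rfl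
  map_mul' e e' := by
    ext x
    exact Quotient.inductionOn' x fun _ => rfl

theorem exists_notMem_center_forall_apply_div_mem_center [Finite N] (hG : IsPGroup p G)
    (Λ : G →* MulAut N) (hN : p ∣ (Subgroup.center N).index) :
    ∃ x ∉ Subgroup.center N, ∀ g, Λ g x / x ∈ Subgroup.center N := by
  obtain ⟨x, x_ne, hx⟩ := exists_ne_one_forall_apply_eq_self hG
    ((mulAutQuotient (Subgroup.center N)).comp Λ) hN
  obtain ⟨x, rfl⟩ := QuotientGroup.mk_surjective x
  refine ⟨x, mt (QuotientGroup.eq_one_iff x).mpr x_ne, fun g => ?_⟩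
  rw [← QuotientGroup.eq_one_iff, QuotientGroup.mk_div, div_eq_one]
  exact hx g

end FixedPoints

section AddCenter

variable {A N : Type*} [AddGroup A] [Group N] (φ : Multiplicative A ≃* N)
include φ

theorem mem_addCenter_iff {a : A} : a ∈ AddSubgroup.center A ↔
    φ (Multiplicative.ofAdd a) ∈ Subgroup.center N := by
  rw [AddSubgroup.mem_center_iff]
  exact Subgroup.mem_center_iff.symm.trans (MulEquivClass.apply_mem_center_iff φ).symm

theorem natCard_addCenter :
    Nat.card (AddSubgroup.center A) = Nat.card (Subgroup.center N) :=
  Nat.card_congr ((Multiplicative.ofAdd.trans φ.toEquiv).subtypeEquiv fun _ =>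
    mem_addCenter_iff φ)

end AddCenter

namespace SkewBrace

section AddLam

variable {B : Type*} [SkewBrace B]

/-- The automorphism `λ_a` of `(B, +)`. -/
def addLam (a : B) : B ≃+ B := AddEquiv.toMultiplicative.symm (lam B a)

theorem addLam_apply (a b : B) : addLam a b = -a + a * b := rfl

theorem mul_eq_add_addLam (a b : B) : a * b = a + addLam a b := by
  rw [addLam_apply, add_neg_cancel_left]

theorem addLam_mul (a b c : B) : addLam (a * b) c = addLam a (addLam b c) := lam_mul a b c

theorem mem_ker_lam_iff {a : B} : a ∈ (lam B).ker ↔ ∀ b, addLam a b = b :=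
  MonoidHom.mem_ker.trans MulEquiv.ext_iff

theorem mul_eq_add_of_mem_ker {a : B} (ha : a ∈ (lam B).ker) (b : B) : a * b = a + b := by
  rw [mul_eq_add_addLam, mem_ker_lam_iff.mp ha]

theorem addLam_inv_self (a : B) : addLam a a⁻¹ = -a := by
  rw [addLam_apply, mul_inv_cancel, one_eq_zero, add_zero]

theorem add_inv_addLam (a b : B) : addLam a (addLam a⁻¹ b) = b := by
  rw [← addLam_mul, mul_inv_cancel]
  exact mem_ker_lam_iff.mp (one_mem _) b

variable (B) in
/-- The kernel of `λ` as a subgroup of `(B, +)`. -/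
def kerAddSubgroup : AddSubgroup B where
  carrier := (lam B).ker
  zero_mem' := one_eq_zero (B := B) ▸ one_mem (lam B).ker
  add_mem' ha hb := mul_eq_add_of_mem_ker ha _ ▸ mul_mem ha hb
  neg_mem' {a} ha := by
    rw [← addLam_inv_self, mem_ker_lam_iff.mp ha]
    exact inv_mem ha

theorem add_mul_comm_iff (a b : B) : b + b * a = b * a + b ↔ AddCommute b⁻¹ a := by
  calc b + b * a = b * a + b
    _ ↔ b + addLam b a = addLam b a + b := by
      rw [mul_eq_add_addLam, add_assoc b (addLam b a) b, add_right_inj]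
    _ ↔ addLam b⁻¹ b + a = a + addLam b⁻¹ b := by
      rw [← (addLam b).apply_eq_iff_eq (x := addLam b⁻¹ b + a), map_add, map_add, add_inv_addLam]
    _ ↔ AddCommute b⁻¹ a := by
      rw [← AddCommute.neg_left_iff, ← addLam_inv_self b⁻¹, inv_inv]
      rfl

theorem mem_socle_iff {a : B} : a ∈ socle B ↔ a ∈ (lam B).ker ∧ a ∈ AddSubgroup.center B := by
  have mem_ker : (∀ b, a + b = a * b) ↔ a ∈ (lam B).ker := by
    simp only [mem_ker_lam_iff, mul_eq_add_addLam, add_right_inj, eq_comm]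
  have mem_center : (∀ b, b + b * a = b * a + b) ↔ a ∈ AddSubgroup.center B := by
    simp only [add_mul_comm_iff, AddSubgroup.mem_center_iff]
    exact (inv_surjective.forall (p := fun b => AddCommute b a)).symm
  rw [← mem_ker, ← mem_center, ← forall_and]
  rfl

/-- Both products are `a + b`: `λ_a = 1`, and `a` is additively central and fixed by `λ_b`. -/
theorem mem_center_of_mem_socle {a : B} (ha : a ∈ socle B) (ha' : ∀ b, addLam b a = a) :
    a ∈ Subgroup.center B := by
  rw [mem_socle_iff] at ha
  refine Subgroup.mem_center_iff.mpr fun b => ?_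
  rw [mul_eq_add_of_mem_ker ha.1, mul_eq_add_addLam, ha']
  exact AddSubgroup.mem_center_iff.mp ha.2 b

end AddLam

section TrivialKernel

variable {B : Type*} [SkewBrace B]

theorem socle_eq_singleton_zero (hB : Nat.card (lam B).ker = 1) : socle B = {0} := by
  have ker_eq_bot : (lam B).ker = ⊥ := Subgroup.card_eq_one.mp hB
  ext a
  rw [mem_socle_iff, ker_eq_bot, Subgroup.mem_bot, one_eq_zero, Set.mem_singleton_iff]
  exact and_iff_left_of_imp fun ha => ha ▸ zero_mem _

theorem annihilator_eq_singleton_zero (hB : Nat.card (lam B).ker = 1) : annihilator B = {0} := by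
  rw [annihilator, socle_eq_singleton_zero hB, Set.inter_eq_left, Set.singleton_subset_iff,
    ← one_eq_zero]
  exact one_mem (Subgroup.center B)

theorem IsAnnihilatorExtension.subsingleton_left {A Q : Type*} [SkewBrace A] [SkewBrace Q]
    {i : A → B} {q : B → Q} (h : IsAnnihilatorExtension i q) (hB : annihilator B = {0}) :
    Subsingleton A := by
  have i_eq_zero (a : A) : i a = 0 := by
    simpa only [hB, Set.mem_singleton_iff] using h.range_subset (Set.mem_range_self a)
  exact ⟨fun a b => h.injective ((i_eq_zero a).trans (i_eq_zero b).symm)⟩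

end TrivialKernel

section CentralElements

variable {B : Type*} [SkewBrace B]

theorem addLam_sub_mem_ker (hcomm : ∀ a b : B, Commute (lam B a) (lam B b)) {z : B}
    (hz : z ∈ AddSubgroup.center B) (hfix : ∀ b, addLam b z = z) (c : B) :
    addLam z c - c ∈ (lam B).ker := by
  have quotient_mem : z * c * (c * z)⁻¹ ∈ (lam B).ker := by
    rw [MonoidHom.mem_ker, map_mul, map_mul, map_inv, map_mul, (hcomm z c).eq, mul_inv_cancel]
  have product_eq : z + addLam z c = z * c * (c * z)⁻¹ + (c + z) := by
    rw [← mul_eq_add_addLam, ← hfix c, ← mul_eq_add_addLam, hfix c,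
      ← mul_eq_add_of_mem_ker quotient_mem, inv_mul_cancel_right]
  have central := AddSubgroup.mem_center_iff.mp hz
  rw [← central, ← add_assoc, add_left_inj] at product_eq
  rwa [product_eq, add_sub_cancel_right]

theorem conj_addLam_sub_mem_ker (hcomm : ∀ a b : B, Commute (lam B a) (lam B b)) {z : B}
    (hz : z ∈ AddSubgroup.center B) (hfix : ∀ b, addLam b z = z) (c d : B) :
    c + (addLam z d - d) - c ∈ kerAddSubgroup B := by
  have cocycle_identity : c + (addLam z d - d) - c =
      -(addLam z c - c) + (addLam z (c + d) - (c + d)) := by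
    simp only [map_add, sub_eq_add_neg, neg_add_rev, neg_neg, add_assoc, neg_add_cancel_left]
  rw [cocycle_identity]
  exact add_mem (neg_mem (addLam_sub_mem_ker hcomm hz hfix c))
    (addLam_sub_mem_ker hcomm hz hfix (c + d))

theorem mem_ker_lam_of_disjoint (hcomm : ∀ a b : B, Commute (lam B a) (lam B b))
    (hclass : ∀ a b : B, a + b - a - b ∈ AddSubgroup.center B)
    (hdisj : Disjoint (kerAddSubgroup B) (AddSubgroup.center B)) {z : B}
    (hz : z ∈ AddSubgroup.center B) (hfix : ∀ b, addLam b z = z) : z ∈ (lam B).ker := by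
  have eq_zero {x : B} := AddSubgroup.disjoint_def.mp hdisj (x := x)
  have difference_central (d : B) : addLam z d - d ∈ AddSubgroup.center B := by
    refine AddSubgroup.mem_center_iff.mpr fun c => ?_
    have commutator_eq_zero : c + (addLam z d - d) - c - (addLam z d - d) = 0 :=
      eq_zero (sub_mem (conj_addLam_sub_mem_ker hcomm hz hfix c d)
        (addLam_sub_mem_ker hcomm hz hfix d : _ ∈ kerAddSubgroup B)) (hclass _ _)
    rwa [sub_eq_zero, sub_eq_iff_eq_add] at commutator_eq_zero
  exact mem_ker_lam_iff.mpr fun d =>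
    sub_eq_zero.mp (eq_zero (addLam_sub_mem_ker hcomm hz hfix d) (difference_central d))

end CentralElements

section OrderPCubed

variable {B : Type*} [SkewBrace B] {p : ℕ} [Fact p.Prime]

theorem addLam_eq_self_of_mem_center (hB : Nat.card B = p ^ 3)
    (hZ : Nat.card (AddSubgroup.center B) = p) (b : B) {z : B} (hz : z ∈ AddSubgroup.center B) :
    addLam b z = z :=
  apply_eq_self_of_mem_center (IsPGroup.of_card (G := B) hB) (lam B)
    ((natCard_addCenter (MulEquiv.refl _)).symm.trans hZ) b
    ((mem_addCenter_iff (MulEquiv.refl _)).mp hz)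

theorem add_commutator_mem_center (hB : Nat.card B = p ^ 3)
    (hZ : Nat.card (AddSubgroup.center B) = p) (a b : B) :
    a + b - a - b ∈ AddSubgroup.center B := by
  have card_quotient : Nat.card (Multiplicative (B ⧸ AddSubgroup.center B)) = p ^ 2 := by
    have h := (AddSubgroup.center B).card_mul_index
    rw [hB, hZ, pow_succ'] at h
    exact Nat.eq_of_mul_eq_mul_left (Fact.out : p.Prime).pos h
  have comm := (IsPGroup.isMulCommutative_of_card_eq_prime_sq card_quotient).is_comm.comm
    (Multiplicative.ofAdd (a : B ⧸ AddSubgroup.center B)) (Multiplicative.ofAdd (b : B ⧸ _))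
  rw [← QuotientAddGroup.eq_zero_iff, QuotientAddGroup.mk_sub, QuotientAddGroup.mk_sub,
    sub_eq_zero, sub_eq_iff_eq_add]
  exact comm

theorem natCard_ker_lam (hB : Nat.card B = p ^ 3) :
    ∃ k ≤ 3, Nat.card (lam B).ker = p ^ k :=
  (Nat.dvd_prime_pow Fact.out).mp (hB ▸ Subgroup.card_subgroup_dvd_card (lam B).ker)

theorem isTrivial_of_natCard_ker_eq_pow_three (hB : Nat.card B = p ^ 3)
    (hker : Nat.card (lam B).ker = p ^ 3) : IsTrivial B := by
  have : Finite B := Nat.finite_of_card_ne_zero (hB ▸ pow_ne_zero 3 (NeZero.ne p))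
  have ker_eq_top : (lam B).ker = ⊤ := Subgroup.eq_top_of_card_eq _ (hker.trans hB.symm)
  exact fun a => mul_eq_add_of_mem_ker (ker_eq_top ▸ Subgroup.mem_top a)

theorem natCard_ker_lam_of_not_isTrivial (hB : Nat.card B = p ^ 3) (h : ¬ IsTrivial B) :
    Nat.card (lam B).ker = p ^ 2 ∨ Nat.card (lam B).ker = p ∨ Nat.card (lam B).ker = 1 := by
  obtain ⟨k, hk, card_ker⟩ := natCard_ker_lam hB
  interval_cases k
  · exact .inr (.inr (by simpa using card_ker))
  · exact .inr (.inl (by simpa using card_ker))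
  · exact .inl card_ker
  · exact absurd (isTrivial_of_natCard_ker_eq_pow_three hB card_ker) h

/-- The image of `λ` has order `p` or `p ^ 2`. -/
theorem commute_lam (hB : Nat.card B = p ^ 3)
    (hker : Nat.card (lam B).ker = p ^ 2 ∨ Nat.card (lam B).ker = p) (a b : B) :
    Commute (lam B a) (lam B b) := by
  have card_range : Nat.card (lam B).ker * Nat.card (lam B).range = p ^ 3 := by
    rw [← Subgroup.index_ker, Subgroup.card_mul_index, hB]
  have range_comm : IsMulCommutative (lam B).range := by
    have p_pos := (Fact.out : p.Prime).pos
    rcases hker with hker | hker <;> rw [hker] at card_range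
    · have := isCyclic_of_prime_card (p := p)
        (Nat.eq_of_mul_eq_mul_left (pow_pos p_pos 2) (card_range.trans (pow_succ p 2)))
      infer_instance
    · exact IsPGroup.isMulCommutative_of_card_eq_prime_sq
        (Nat.eq_of_mul_eq_mul_left p_pos (card_range.trans (pow_succ' p 2)))
  exact congrArg Subtype.val
    (range_comm.is_comm.comm ⟨lam B a, a, rfl⟩ ⟨lam B b, b, rfl⟩)

theorem center_le_kerAddSubgroup (hB : Nat.card B = p ^ 3)
    (hZ : Nat.card (AddSubgroup.center B) = p)
    (hker : Nat.card (lam B).ker = p ^ 2 ∨ Nat.card (lam B).ker = p) :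
    AddSubgroup.center B ≤ kerAddSubgroup B := by
  have : Fact (Nat.card (AddSubgroup.center B)).Prime := ⟨hZ ▸ Fact.out⟩
  rcases ((kerAddSubgroup B).addSubgroupOf (AddSubgroup.center B)).eq_bot_or_eq_top_of_prime_card
    with h | h
  · exact fun z hz => mem_ker_lam_of_disjoint (commute_lam hB hker)
      (add_commutator_mem_center hB hZ) (AddSubgroup.addSubgroupOf_eq_bot.mp h) hz
      fun b => addLam_eq_self_of_mem_center hB hZ b hz
  · exact AddSubgroup.addSubgroupOf_eq_top.mp h

theorem socle_eq_center (hB : Nat.card B = p ^ 3) (hZ : Nat.card (AddSubgroup.center B) = p)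
    (hker : Nat.card (lam B).ker = p ^ 2 ∨ Nat.card (lam B).ker = p) :
    socle B = (AddSubgroup.center B : Set B) := by
  ext a
  rw [mem_socle_iff, SetLike.mem_coe]
  exact and_iff_right_of_imp (center_le_kerAddSubgroup hB hZ hker ·)

theorem annihilator_eq_center (hB : Nat.card B = p ^ 3)
    (hZ : Nat.card (AddSubgroup.center B) = p)
    (hker : Nat.card (lam B).ker = p ^ 2 ∨ Nat.card (lam B).ker = p) :
    annihilator B = (AddSubgroup.center B : Set B) := by
  have socle_eq := socle_eq_center hB hZ hker
  rw [annihilator, Set.inter_eq_left.mpr, socle_eq]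
  intro z hz
  exact mem_center_of_mem_socle hz fun b =>
    addLam_eq_self_of_mem_center hB hZ b (socle_eq.subset hz)

end OrderPCubed

end SkewBrace

section CrossedHom

variable {G G' N N' : Type*} [Group G] [Group G'] [Group N] [Group N']

namespace Hol

/-- `π` is a crossed homomorphism (a `1`-cocycle) for the action `Λ` of `G` on `N`: the condition
under which `u ↦ π u Λ_u` is a homomorphism into the holomorph. -/
def IsCrossedHom (Λ : G →* MulAut N) (π : G → N) : Prop :=
  ∀ u v, π (u * v) = π u * Λ u (π v)

namespace IsCrossedHom

variable {Λ : G →* MulAut N} {π : G → N}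

theorem map_one (h : IsCrossedHom Λ π) : π 1 = 1 := by
  have h₁ := h 1 1
  rwa [mul_one, _root_.map_one, MulAut.one_apply, left_eq_mul] at h₁

/-- The homomorphism `u ↦ π u Λ_u` into the holomorph given by a crossed homomorphism. -/
def toHom (h : IsCrossedHom Λ π) : G →* Hol N where
  toFun u := ⟨π u, Λ u⟩
  map_one' := SemidirectProduct.ext h.map_one (_root_.map_one Λ)
  map_mul' u v := SemidirectProduct.ext (h u v) (map_mul Λ u v)

theorem toHom_apply (h : IsCrossedHom Λ π) (u : G) : h.toHom u = ⟨π u, Λ u⟩ := rfl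

theorem act_toHom_map (h : IsCrossedHom Λ π) (u v : G) : act (h.toHom u) (π v) = π (u * v) :=
  (h u v).symm

theorem isRegular_range (h : IsCrossedHom Λ π) (hπ : Function.Bijective π) :
    IsRegular h.toHom.range := by
  intro x y
  obtain ⟨a, rfl⟩ := hπ.surjective x
  obtain ⟨b, rfl⟩ := hπ.surjective y
  refine ⟨⟨h.toHom (b * a⁻¹), b * a⁻¹, rfl⟩, ?_, ?_⟩
  · change act (h.toHom (b * a⁻¹)) (π a) = π b
    rw [h.act_toHom_map, inv_mul_cancel_right]
  · rintro ⟨_, u, rfl⟩ hu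
    change act (h.toHom u) (π a) = π b at hu
    rw [h.act_toHom_map, hπ.injective.eq_iff] at hu
    exact Subtype.ext (congrArg h.toHom (eq_mul_inv_of_mul_eq hu))

theorem conj (h : IsCrossedHom Λ π) (v : G) :
    IsCrossedHom Λ fun u => Λ v (π (v⁻¹ * u * v)) := by
  intro u w
  have expand : v⁻¹ * (u * w) * v = v⁻¹ * u * v * (v⁻¹ * w * v) := by group
  simp only [expand, h (v⁻¹ * u * v), map_mul, map_inv, MulAut.mul_apply, MulAut.apply_inv_self]

/-- The intertwining is forced by `θ ∘ π = π' ∘ ω` because `π` is onto. -/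
theorem intertwine {Λ' : G' →* MulAut N'} {π' : G' → N'} (h : IsCrossedHom Λ π)
    (h' : IsCrossedHom Λ' π') (hπ : Function.Surjective π) (θ : N ≃* N') (ω : G ≃* G')
    (hθ : ∀ u, θ (π u) = π' (ω u)) (u : G) (x : N) : θ (Λ u x) = Λ' (ω u) (θ x) := by
  obtain ⟨v, rfl⟩ := hπ x
  have huv := hθ (u * v)
  rwa [h, map_mul, map_mul, h', hθ u, mul_right_inj, ← hθ v] at huv

end IsCrossedHom

end Hol

namespace SkewBrace

/-- A chart identifies `(B, +)` with `N` and `(B, *)` with `G`, and `π : G → N` is then the identity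
of `B` read in these coordinates. The isomorphism class of `B` is determined by `π`. -/
structure Chart (B : Type*) [SkewBrace B] (π : G → N) where
  /-- The identification of the additive group. -/
  add : Multiplicative B ≃* N
  /-- The identification of the multiplicative group. -/
  mul : G ≃* B
  add_mul : ∀ u, add (Multiplicative.ofAdd (mul u)) = π u

namespace Chart

variable {B B' : Type*} [SkewBrace B] [SkewBrace B'] {π : G → N} {π' : G' → N'}

theorem bijective (c : Chart B π) : Function.Bijective π := by
  rw [← funext c.add_mul]
  exact c.add.bijective.comp (Multiplicative.ofAdd.bijective.comp c.mul.bijective)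

theorem isCrossedHom_iff (c : Chart B π) {Λ : G →* MulAut N} :
    Hol.IsCrossedHom Λ π ↔ ∀ u b, c.add (lam B (c.mul u) b) = Λ u (c.add b) := by
  have add_lam (u v : G) :
      c.add (lam B (c.mul u) (Multiplicative.ofAdd (c.mul v))) = (π u)⁻¹ * π (u * v) := by
    rw [← c.add_mul, ← c.add_mul, ← map_inv, ← map_mul, map_mul c.mul]
    rfl
  refine forall_congr' fun u => ?_
  rw [(Multiplicative.ofAdd.surjective.comp c.mul.surjective).forall]
  refine forall_congr' fun v => ?_
  rw [Function.comp_apply, add_lam, c.add_mul, inv_mul_eq_iff_eq_mul]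

theorem natCard_ker_lam (c : Chart B π) {Λ : G →* MulAut N} (h : Hol.IsCrossedHom Λ π)
    (hΛ : Function.Injective Λ) : Nat.card (lam B).ker = 1 := by
  rw [Subgroup.card_eq_one, Subgroup.eq_bot_iff_forall, c.mul.surjective.forall]
  intro u hu
  have hΛu : Λ u = 1 := by
    ext x
    obtain ⟨b, rfl⟩ := c.add.surjective x
    rw [← c.isCrossedHom_iff.mp h, MonoidHom.mem_ker.mp hu]
    rfl
  rw [(map_eq_one_iff Λ hΛ).mp hΛu, map_one]

theorem exists_of_range_eq (φ : Multiplicative B ≃* N) (hker : Function.Injective (lam B))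
    {Λ : G →* MulAut N} (hΛ : Function.Injective Λ)
    (hrange : ((MulAut.congr φ).toMonoidHom.comp (lam B)).range = Λ.range) :
    ∃ π : G → N, Hol.IsCrossedHom Λ π ∧ Nonempty (Chart B π) := by
  let Ψ : B →* MulAut N := (MulAut.congr φ).toMonoidHom.comp (lam B)
  have hΨ : Function.Injective Ψ := (MulAut.congr φ).injective.comp hker
  let e : G ≃* B := (MonoidHom.ofInjective hΛ).trans
    ((MulEquiv.subgroupCongr hrange.symm).trans (MonoidHom.ofInjective hΨ).symm)
  have Ψ_e (u : G) : Ψ (e u) = Λ u :=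
    congrArg Subtype.val ((MonoidHom.ofInjective hΨ).apply_symm_apply _)
  let c : Chart B fun u => φ (Multiplicative.ofAdd (e u)) := ⟨φ, e, fun _ => rfl⟩
  refine ⟨_, c.isCrossedHom_iff.mpr fun u b => ?_, ⟨c⟩⟩
  rw [← Ψ_e]
  exact congrArg (fun b => φ (lam B (e u) b)) (φ.symm_apply_apply b).symm

/-- Two skew braces with the same chart are isomorphic. -/
def equiv {π : G → N} (c : Chart B π) (c' : Chart B' π) : B ≃+* B' where
  toEquiv := (c.mul.symm.trans c'.mul).toEquiv
  map_mul' := map_mul (c.mul.symm.trans c'.mul)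
  map_add' a b := by
    have add_eq (b : B) : c'.add (Multiplicative.ofAdd (c'.mul (c.mul.symm b))) =
        c.add (Multiplicative.ofAdd b) := by
      rw [c'.add_mul, ← c.add_mul, MulEquiv.apply_symm_apply]
    apply Multiplicative.ofAdd.injective
    apply c'.add.injective
    change c'.add (Multiplicative.ofAdd (c'.mul (c.mul.symm (a + b)))) =
      c'.add (Multiplicative.ofAdd (c'.mul (c.mul.symm a)) *
        Multiplicative.ofAdd (c'.mul (c.mul.symm b)))
    rw [map_mul, add_eq, add_eq, add_eq, ofAdd_add, map_mul]

/-- Pullback of a chart along an isomorphism of skew braces. -/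
def comap (c : Chart B' π) (e : B ≃+* B') : Chart B π where
  add := (AddEquiv.toMultiplicative e.toAddEquiv).trans c.add
  mul := c.mul.trans e.toMulEquiv.symm
  add_mul u := by
    change c.add (Multiplicative.ofAdd (e (e.symm (c.mul u)))) = π u
    rw [e.apply_symm_apply, c.add_mul]

/-- Change of coordinates on the additive and on the multiplicative group. -/
def trans (c : Chart B π) (θ : N ≃* N') (ω : G ≃* G') (h : ∀ u, θ (π u) = π' (ω u)) :
    Chart B π' where
  add := c.add.trans θ
  mul := ω.symm.trans c.mul
  add_mul u := by
    simp only [MulEquiv.trans_apply, c.add_mul, h, ω.apply_symm_apply]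

theorem exists_intertwiner (c : Chart B π) (c' : Chart B π') :
    ∃ (θ : N ≃* N') (ω : G ≃* G'), ∀ u, θ (π u) = π' (ω u) := by
  refine ⟨c.add.symm.trans c'.add, c.mul.trans c'.mul.symm, fun u => ?_⟩
  simp only [MulEquiv.trans_apply, ← c.add_mul, ← c'.add_mul, MulEquiv.symm_apply_apply,
    MulEquiv.apply_symm_apply]

end Chart

end SkewBrace

namespace Hol.Brace

variable {H : Subgroup (Hol N)} {hH : IsRegular H}

/-- A homomorphism parametrising a regular subgroup is a chart of its skew brace. -/
noncomputable def chart {Λ : G →* MulAut N} {π : G → N} (h : IsCrossedHom Λ π)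
    (hπ : Function.Injective π) (hreg : IsRegular h.toHom.range) :
    SkewBrace.Chart (Brace h.toHom.range hreg) π where
  add := { toEquiv := Multiplicative.toAdd.trans psi, map_mul' := psi_add }
  mul := MonoidHom.ofInjective (f := h.toHom) fun _ _ huv =>
    hπ (congrArg SemidirectProduct.left huv)
  add_mul u := by
    change π u * Λ u 1 = π u
    rw [map_one, mul_one]

end Hol.Brace

end CrossedHom

section SquareClasses

variable {F : Type*} [Field F]

theorem ne_zero_of_eq_one_or_eq {δ s : F} (hδ : ¬IsSquare δ) (hs : s = 1 ∨ s = δ) : s ≠ 0 := by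
  rcases hs with rfl | rfl
  · exact one_ne_zero
  · rintro rfl
    exact hδ IsSquare.zero

theorem exists_sq_mul_eq [Finite F] {δ s : F} (hδ : ¬IsSquare δ) (hs : s ≠ 0) :
    ∃ a : F, a ≠ 0 ∧ (a ^ 2 * s = 1 ∨ a ^ 2 * s = δ) := by
  have := Fintype.ofFinite F
  classical
  by_cases h : IsSquare s
  · obtain ⟨b, rfl⟩ := h
    have hb : b ≠ 0 := left_ne_zero_of_mul hs
    exact ⟨b⁻¹, inv_ne_zero hb, Or.inl (by field_simp)⟩
  · have hsq : IsSquare (δ * s) := by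
      by_contra hn
      rw [← quadraticChar_neg_one_iff_not_isSquare] at hδ h hn
      rw [map_mul, hδ, h] at hn
      norm_num at hn
    obtain ⟨b, hb⟩ := hsq
    have hδ₀ : δ ≠ 0 := ne_zero_of_eq_one_or_eq hδ (.inr rfl)
    have hb₀ : b ≠ 0 := left_ne_zero_of_mul (hb ▸ mul_ne_zero hδ₀ hs)
    refine ⟨b / s, div_ne_zero hb₀ hs, Or.inr ?_⟩
    field_simp
    linear_combination -hb

theorem eq_and_eq_of_rescale {δ : F} (hδ : ¬IsSquare δ) {s t s' t' a d : F}
    (ha : a ≠ 0) (hd : d ≠ 0) (hs : s = 1 ∨ s = δ) (ht : t = 0 ∨ t = 1) (hs' : s' = 1 ∨ s' = δ)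
    (ht' : t' = 0 ∨ t' = 1) (h_s : s' = a ^ 2 * s) (h_t : t' * a = d * t) :
    s = s' ∧ t = t' := by
  constructor
  · rcases hs with rfl | rfl <;> rcases hs' with rfl | rfl
    · rfl
    · exact absurd ⟨a, by rw [h_s]; ring⟩ hδ
    · exact absurd ⟨a⁻¹, by field_simp; rw [h_s]; ring⟩ hδ
    · rfl
  · rcases ht with rfl | rfl <;> rcases ht' with rfl | rfl <;> simp_all

end SquareClasses

namespace M1

variable {p : ℕ}

theorem neZero_two [Fact p.Prime] (hp : 3 < p) : NeZero (2 : ZMod p) :=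
  ⟨Ring.two_ne_zero (by rw [ZMod.ringChar_zmod_n]; lia)⟩

@[simp] theorem rho_r : (rho : M1 p).r = 1 := rfl
@[simp] theorem rho_s : (rho : M1 p).s = 0 := rfl
@[simp] theorem rho_t : (rho : M1 p).t = 0 := rfl
@[simp] theorem sigma_r : (sigma : M1 p).r = 0 := rfl
@[simp] theorem sigma_s : (sigma : M1 p).s = 1 := rfl
@[simp] theorem sigma_t : (sigma : M1 p).t = 0 := rfl
@[simp] theorem tau_r : (tau : M1 p).r = 0 := rfl
@[simp] theorem tau_s : (tau : M1 p).s = 0 := rfl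
@[simp] theorem tau_t : (tau : M1 p).t = 1 := rfl

section Group

/-- The coordinates `r, s, t` identify the set `M1 p` with `(ℤ/p)³`. -/
def equivProd (p : ℕ) : M1 p ≃ ZMod p × ZMod p × ZMod p where
  toFun x := (x.r, x.s, x.t)
  invFun x := ⟨x.1, x.2.1, x.2.2⟩

theorem natCard (p : ℕ) : Nat.card (M1 p) = p ^ 3 := by
  rw [Nat.card_congr (equivProd p), Nat.card_prod, Nat.card_prod, Nat.card_zmod]
  ring

instance [NeZero p] : Finite (M1 p) := Finite.of_equiv _ (equivProd p).symm

@[simp] theorem pow_s (x : M1 p) (n : ℕ) : (x ^ n).s = n * x.s := by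
  induction n with
  | zero => simp
  | succ n ih => rw [pow_succ, mul_s, ih]; push_cast; ring

@[simp] theorem pow_t (x : M1 p) (n : ℕ) : (x ^ n).t = n * x.t := by
  induction n with
  | zero => simp
  | succ n ih => rw [pow_succ, mul_t, ih]; push_cast; ring

theorem pow_r_of_s_eq_zero {x : M1 p} (hx : x.s = 0) (n : ℕ) : (x ^ n).r = n * x.r := by
  induction n with
  | zero => simp
  | succ n ih => rw [pow_succ, mul_r, ih, hx]; push_cast; ring

theorem eq_pow_mul_pow_mul_pow [NeZero p] (x : M1 p) :
    x = rho ^ x.r.val * sigma ^ x.s.val * tau ^ x.t.val := by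
  rw [rho_pow, sigma_pow, tau_pow]
  ext <;> simp

theorem closure_eq_top [NeZero p] :
    Subgroup.closure {(rho : M1 p), sigma, tau} = ⊤ := by
  refine (Subgroup.eq_top_iff' _).mpr fun x => ?_
  rw [eq_pow_mul_pow_mul_pow x]
  refine mul_mem (mul_mem ?_ ?_) ?_ <;> exact pow_mem (Subgroup.subset_closure (by simp)) _

theorem monoidHom_ext [NeZero p] {G : Type*} [Group G] {f g : M1 p →* G}
    (hr : f rho = g rho) (hs : f sigma = g sigma) (ht : f tau = g tau) : f = g := by
  refine MonoidHom.eq_of_eqOn_dense closure_eq_top ?_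
  rintro x (rfl | rfl | rfl) <;> assumption

theorem mem_center_iff {x : M1 p} : x ∈ Subgroup.center (M1 p) ↔ x.s = 0 ∧ x.t = 0 := by
  rw [Subgroup.mem_center_iff]
  constructor
  · intro h
    have h_sigma := congrArg M1.r (h sigma)
    have h_tau := congrArg M1.r (h tau)
    simp only [sigma, tau, mul_r] at h_sigma h_tau
    exact ⟨by linear_combination h_tau, by linear_combination -h_sigma⟩
  · rintro ⟨hs, ht⟩ y
    ext <;> simp [hs, ht, add_comm]

theorem zpowers_rho_eq_center [NeZero p] :
    Subgroup.zpowers (rho : M1 p) = Subgroup.center (M1 p) := by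
  refine le_antisymm (Subgroup.zpowers_le.mpr (mem_center_iff.mpr ⟨rfl, rfl⟩)) fun x hx => ?_
  obtain ⟨hs, ht⟩ := mem_center_iff.mp hx
  have rho_pow_eq : rho ^ x.r.val = x := by
    rw [rho_pow]
    ext <;> simp [hs, ht]
  exact rho_pow_eq ▸ Subgroup.npow_mem_zpowers rho x.r.val

theorem natCard_center (p : ℕ) : Nat.card (Subgroup.center (M1 p)) = p := by
  let centerEquiv : Subgroup.center (M1 p) ≃ ZMod p :=
    { toFun z := z.1.r
      invFun a := ⟨⟨a, 0, 0⟩, mem_center_iff.mpr ⟨rfl, rfl⟩⟩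
      left_inv z := Subtype.ext (M1.ext rfl (mem_center_iff.mp z.2).1.symm
        (mem_center_iff.mp z.2).2.symm)
      right_inv _ := rfl }
  rw [Nat.card_congr centerEquiv, Nat.card_zmod]

theorem index_center [NeZero p] : (Subgroup.center (M1 p)).index = p ^ 2 := by
  have h := (Subgroup.center (M1 p)).card_mul_index
  rw [natCard_center, natCard, pow_succ'] at h
  exact Nat.eq_of_mul_eq_mul_left (NeZero.pos p) h

end Group

section Transport

variable {A : Type*} [AddGroup A] (φ : Multiplicative A ≃* M1 p)
include φ

theorem natCard_of_mulEquiv : Nat.card A = p ^ 3 :=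
  (Nat.card_congr (Multiplicative.ofAdd.trans φ.toEquiv)).trans (natCard p)

theorem natCard_addCenter_of_mulEquiv : Nat.card (AddSubgroup.center A) = p :=
  (natCard_addCenter φ).trans (natCard_center p)

theorem addCenter_eq_preimage_zpowers_rho [NeZero p] : (AddSubgroup.center A : Set A) =
    {a | φ (Multiplicative.ofAdd a) ∈ Subgroup.zpowers rho} := by
  rw [zpowers_rho_eq_center]
  exact Set.ext fun _ => mem_addCenter_iff φ

end Transport

section Endomorphisms

theorem tau_mul_sigma : (tau : M1 p) * sigma = rho * sigma * tau := by
  ext <;> simp [rho, sigma, tau]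

theorem sigma_mul_rho : (sigma : M1 p) * rho = rho * sigma := by
  ext <;> simp [rho, sigma]

theorem tau_mul_rho : (tau : M1 p) * rho = rho * tau := by
  ext <;> simp [rho, tau]

variable {F : Type*} [FunLike F (M1 p) (M1 p)] [MonoidHomClass F (M1 p) (M1 p)] (θ : F)

theorem map_rho : θ rho = ⟨(θ sigma).s * (θ tau).t - (θ sigma).t * (θ tau).s, 0, 0⟩ := by
  have rho_eq : (rho : M1 p) = tau * sigma * tau⁻¹ * sigma⁻¹ := by
    rw [tau_mul_sigma]
    group
  rw [rho_eq, map_mul, map_mul, map_mul, map_inv, map_inv]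
  ext <;> simp only [mul_r, mul_s, mul_t, inv_r, inv_s, inv_t] <;> ring

theorem map_s [NeZero p] (x : M1 p) : (θ x).s = x.s * (θ sigma).s + x.t * (θ tau).s := by
  conv_lhs => rw [eq_pow_mul_pow_mul_pow x]
  simp [map_rho θ]

theorem map_t [NeZero p] (x : M1 p) : (θ x).t = x.s * (θ sigma).t + x.t * (θ tau).t := by
  conv_lhs => rw [eq_pow_mul_pow_mul_pow x]
  simp [map_rho θ]

theorem map_r_of_s_eq_zero [NeZero p] (hθ : (θ tau).s = 0) {x : M1 p} (hx : x.s = 0) :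
    (θ x).r = x.r * (θ rho).r + x.t * (θ tau).r := by
  conv_lhs => rw [eq_pow_mul_pow_mul_pow x]
  simp [map_rho θ, hx, hθ, pow_r_of_s_eq_zero]

theorem mulAut_ext [NeZero p] {θ θ' : MulAut (M1 p)} (hs : θ sigma = θ' sigma)
    (ht : θ tau = θ' tau) : θ = θ' := by
  have h : θ.toMonoidHom = θ'.toMonoidHom := monoidHom_ext (by
    change θ rho = θ' rho
    rw [map_rho, map_rho, hs, ht]) hs ht
  exact MulEquiv.toMonoidHom_injective h

end Endomorphisms

section Automorphisms

variable [Fact p.Prime] [NeZero (2 : ZMod p)]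

/-- The automorphism `α₁ ^ f α₂ ^ g α₃ ^ h` attached to `ρ ^ f σ ^ g τ ^ h`. -/
def unip : M1 p →* MulAut (M1 p) where
  toFun u :=
    { toFun x :=
        ⟨x.r + u.r * x.s + u.t * x.t + u.s * (x.s * (x.s - 1) / 2), x.s, x.t + u.s * x.s⟩
      invFun x :=
        ⟨x.r + (u⁻¹).r * x.s + (u⁻¹).t * x.t + (u⁻¹).s * (x.s * (x.s - 1) / 2), x.s,
          x.t + (u⁻¹).s * x.s⟩
      left_inv x := by ext <;> simp only [inv_r, inv_s, inv_t] <;> ring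
      right_inv x := by ext <;> simp only [inv_r, inv_s, inv_t] <;> ring
      map_mul' x y := by
        have h2 := two_ne_zero (α := ZMod p)
        ext
        · simp only [mul_r, mul_s, mul_t]
          field_simp
          ring
        · simp
        · simp only [mul_s, mul_t]
          ring }
  map_one' := by ext <;> simp
  map_mul' u v := by
    ext <;> simp only [MulAut.mul_apply, MulEquiv.coe_mk, Equiv.coe_fn_mk, mul_r, mul_s, mul_t] <;>
      ring

theorem unip_apply (u x : M1 p) : unip u x =
    ⟨x.r + u.r * x.s + u.t * x.t + u.s * (x.s * (x.s - 1) / 2), x.s, x.t + u.s * x.s⟩ := rfl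

theorem unip_sigma_right (u : M1 p) : unip u sigma = ⟨u.r, 1, u.s⟩ := by
  ext <;> simp [unip_apply, sigma]

theorem unip_tau_right (u : M1 p) : unip u tau = ⟨u.t, 0, 1⟩ := by
  ext <;> simp [unip_apply, tau]

theorem unip_injective : Function.Injective (unip (p := p)) := by
  intro u v h
  have h_sigma := DFunLike.congr_fun h sigma
  have h_tau := DFunLike.congr_fun h tau
  rw [unip_sigma_right, unip_sigma_right, M1.ext_iff] at h_sigma
  rw [unip_tau_right, unip_tau_right, M1.ext_iff] at h_tau
  exact M1.ext h_sigma.1 h_sigma.2.2 h_tau.1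

theorem mem_range_unip {θ : MulAut (M1 p)} (hr : θ rho = rho) (hs : (θ tau).s = 0)
    (ht : (θ tau).t = 1) : θ ∈ (unip (p := p)).range := by
  have h_rho := congrArg M1.r hr
  rw [map_rho, hs, ht, mul_zero, sub_zero, mul_one] at h_rho
  refine ⟨⟨(θ sigma).r, (θ sigma).t, (θ tau).r⟩, mulAut_ext ?_ ?_⟩
  · rw [unip_sigma_right]
    exact M1.ext rfl h_rho.symm rfl
  · rw [unip_tau_right]
    exact M1.ext rfl hs.symm ht.symm

/-- The endomorphism inducing `σ ↦ σ ^ a τ ^ c`, `τ ↦ σ ^ b τ ^ d` modulo the center. The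
correction terms make it linear in the coordinate `r - s t / 2`. -/
def linHom (a b c d : ZMod p) : M1 p →* M1 p where
  toFun x := ⟨(a * d - b * c) * (x.r - x.s * x.t / 2) +
    (a * x.s + b * x.t) * (c * x.s + d * x.t) / 2, a * x.s + b * x.t, c * x.s + d * x.t⟩
  map_one' := by ext <;> simp
  map_mul' x y := by
    have h2 := two_ne_zero (α := ZMod p)
    ext
    · simp only [mul_r, mul_s, mul_t]
      field_simp
      ring
    · simp only [mul_s, mul_t]
      ring
    · simp only [mul_s, mul_t]
      ring

theorem linHom_apply (a b c d : ZMod p) (x : M1 p) : linHom a b c d x =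
    ⟨(a * d - b * c) * (x.r - x.s * x.t / 2) + (a * x.s + b * x.t) * (c * x.s + d * x.t) / 2,
      a * x.s + b * x.t, c * x.s + d * x.t⟩ := rfl

theorem linHom_bijective {a b c d : ZMod p} (h : a * d - b * c ≠ 0) :
    Function.Bijective (linHom a b c d) := by
  refine Finite.injective_iff_bijective.mp ((injective_iff_map_eq_one _).mpr fun x hx => ?_)
  obtain ⟨hr, hs, ht⟩ := M1.ext_iff.mp hx
  simp only [linHom_apply, one_r, one_s, one_t] at hr hs ht
  have xs : x.s = 0 := mul_left_cancel₀ h (by linear_combination d * hs - b * ht)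
  have xt : x.t = 0 := mul_left_cancel₀ h (by linear_combination a * ht - c * hs)
  have xr : x.r = 0 := by simpa [xs, xt, h] using hr
  exact M1.ext xr xs xt

/-- The automorphism with invertible linear part `a, b, c, d`. -/
noncomputable def linAut {a b c d : ZMod p} (h : a * d - b * c ≠ 0) : MulAut (M1 p) :=
  MulEquiv.ofBijective (linHom a b c d) (linHom_bijective h)

theorem linAut_apply {a b c d : ZMod p} (h : a * d - b * c ≠ 0) (x : M1 p) :
    linAut h x = linHom a b c d x := rfl

theorem exists_mulAut_apply_eq_zero_one {x : M1 p} (hx : x ∉ Subgroup.center (M1 p)) :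
    ∃ θ : MulAut (M1 p), (θ x).s = 0 ∧ (θ x).t = 1 := by
  obtain ⟨c, d, bezout⟩ : ∃ c d, c * x.s + d * x.t = 1 := by
    rw [mem_center_iff, not_and_or] at hx
    rcases hx with h | h
    · exact ⟨x.s⁻¹, 0, by rw [inv_mul_cancel₀ h, zero_mul, add_zero]⟩
    · exact ⟨0, x.t⁻¹, by rw [inv_mul_cancel₀ h, zero_mul, zero_add]⟩
  have det_ne : x.t * d - -x.s * c ≠ 0 := by
    rw [show x.t * d - -x.s * c = 1 by linear_combination bezout]
    exact one_ne_zero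
  refine ⟨linAut det_ne, ?_, bezout⟩
  rw [linAut_apply, linHom_apply]
  ring

/-- The range of `unip` is a Sylow `p`-subgroup of `Aut M₁`. -/
theorem exists_conj_mem_range_unip {G : Type*} [Group G] (hG : IsPGroup p G)
    (Λ : G →* MulAut (M1 p)) :
    ∃ θ : MulAut (M1 p), ∀ g, θ * Λ g * θ⁻¹ ∈ (unip (p := p)).range := by
  obtain ⟨x, x_notMem, hx⟩ := exists_notMem_center_forall_apply_div_mem_center hG Λ
    (index_center (p := p) ▸ dvd_pow_self p two_ne_zero)
  obtain ⟨θ, θx_s, θx_t⟩ := exists_mulAut_apply_eq_zero_one x_notMem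
  refine ⟨θ, fun g => ?_⟩
  have rho_fixed : (θ * Λ g * θ⁻¹) rho = rho :=
    apply_eq_self_of_mem_center hG ((MulAut.conj θ).toMonoidHom.comp Λ) (natCard_center p) g
      (mem_center_iff.mpr ⟨rfl, rfl⟩)
  have displacement_central : (θ * Λ g * θ⁻¹) (θ x) / θ x ∈ Subgroup.center (M1 p) := by
    rw [MulAut.mul_apply, MulAut.mul_apply, MulAut.inv_apply_self, ← map_div]
    exact MulEquivClass.apply_mem_center θ (hx g)
  obtain ⟨h_s, h_t⟩ := mem_center_iff.mp displacement_central
  rw [div_eq_mul_inv, mul_s, inv_s, map_s, θx_s, θx_t] at h_s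
  rw [div_eq_mul_inv, mul_t, inv_t, map_t, θx_s, θx_t] at h_t
  exact mem_range_unip rho_fixed (by linear_combination h_s) (by linear_combination h_t)

theorem exists_chart {B : Type*} [SkewBrace B] (φ : Multiplicative B ≃* M1 p)
    (hker : Nat.card (SkewBrace.lam B).ker = 1) :
    ∃ π : M1 p → M1 p, Hol.IsCrossedHom unip π ∧ Nonempty (SkewBrace.Chart B π) := by
  have card_B := natCard_of_mulEquiv φ
  have lam_injective : Function.Injective (SkewBrace.lam B) :=
    (MonoidHom.ker_eq_bot_iff _).mp (Subgroup.card_eq_one.mp hker)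
  obtain ⟨θ, hθ⟩ := exists_conj_mem_range_unip (IsPGroup.of_card card_B)
    ((MulAut.congr φ).toMonoidHom.comp (SkewBrace.lam B))
  refine SkewBrace.Chart.exists_of_range_eq (φ.trans θ) lam_injective unip_injective ?_
  have range_le : ((MulAut.congr (φ.trans θ)).toMonoidHom.comp (SkewBrace.lam B)).range ≤
      (unip (p := p)).range := by
    rintro _ ⟨b, rfl⟩
    exact hθ b
  have lam_conj_injective := (MulAut.congr (φ.trans θ)).injective.comp lam_injective
  refine Subgroup.eq_of_le_of_card_ge range_le (le_of_eq ?_)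
  rw [← Nat.card_congr (MonoidHom.ofInjective unip_injective).toEquiv, natCard, ← card_B]
  exact Nat.card_congr (MonoidHom.ofInjective lam_conj_injective).toEquiv

end Automorphisms

section Cocycles

variable [Fact p.Prime]

/-- The crossed homomorphism for `unip` with `ρ ↦ τ⁻²`, `σ ↦ ρ ^ s τ`, `τ ↦ σ² τ ^ t`. -/
def cocycle (s t : ZMod p) (u : M1 p) : M1 p :=
  ⟨-2 * u.r * u.t + 2 * u.s * u.t ^ 2 + 3 / 2 * t * (u.t ^ 2 - u.t) + u.s * u.t + s * u.s,
    2 * u.t, -2 * u.r + 2 * u.s * u.t + u.s + t * u.t⟩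

theorem cocycle_rho (s t : ZMod p) : cocycle s t rho = ⟨0, 0, -2⟩ := by
  ext <;> simp [cocycle, rho]

theorem cocycle_sigma (s t : ZMod p) : cocycle s t sigma = ⟨s, 0, 1⟩ := by
  ext <;> simp [cocycle, sigma]

theorem cocycle_tau (s t : ZMod p) : cocycle s t tau = ⟨0, 2, t⟩ := by
  ext <;> simp [cocycle, tau]

theorem ne_zero_of_cocycle_injective {s t : ZMod p} (h : Function.Injective (cocycle s t)) :
    s ≠ 0 := by
  rintro rfl
  have collision : cocycle 0 t ⟨1, 2, 0⟩ = cocycle 0 t 1 := by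
    ext <;> simp [cocycle]
  exact one_ne_zero (congrArg M1.r (h collision))

variable [NeZero (2 : ZMod p)]

theorem isCrossedHom_cocycle (s t : ZMod p) : Hol.IsCrossedHom unip (cocycle s t) := by
  have h2 := two_ne_zero (α := ZMod p)
  intro u v
  ext
  · simp only [cocycle, unip_apply, mul_r, mul_s, mul_t]
    field_simp
    ring
  · simp only [cocycle, unip_apply, mul_s, mul_t]
    ring
  · simp only [cocycle, unip_apply, mul_r, mul_s, mul_t]
    ring

theorem cocycle_injective {s : ZMod p} (hs : s ≠ 0) (t : ZMod p) :
    Function.Injective (cocycle s t) := by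
  have h2 := two_ne_zero (α := ZMod p)
  intro u v h
  obtain ⟨h_r, h_s, h_t⟩ := M1.ext_iff.mp h
  simp only [cocycle] at h_r h_s h_t
  have t_eq : u.t = v.t := mul_left_cancel₀ h2 h_s
  rw [t_eq] at h_r h_t
  have s_eq : u.s = v.s := mul_left_cancel₀ hs (by linear_combination h_r - v.t * h_t)
  rw [s_eq] at h_t
  have r_eq : u.r = v.r := mul_left_cancel₀ h2 (by linear_combination -h_t)
  exact M1.ext r_eq s_eq t_eq

theorem cocycle_bijective {s : ZMod p} (hs : s ≠ 0) (t : ZMod p) :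
    Function.Bijective (cocycle s t) :=
  Finite.injective_iff_bijective.mp (cocycle_injective hs t)

end Cocycles

section NormalForm

variable [Fact p.Prime]

theorem isCrossedHom_ext {N : Type*} [Group N] {Λ : M1 p →* MulAut N} {π π' : M1 p → N}
    (h : Hol.IsCrossedHom Λ π) (h' : Hol.IsCrossedHom Λ π') (hr : π rho = π' rho)
    (hs : π sigma = π' sigma) (ht : π tau = π' tau) : π = π' := by
  have toHom_eq : h.toHom = h'.toHom :=
    monoidHom_ext (SemidirectProduct.ext hr rfl) (SemidirectProduct.ext hs rfl)
      (SemidirectProduct.ext ht rfl)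
  exact funext fun u => congrArg SemidirectProduct.left (DFunLike.congr_fun toHom_eq u)

variable [NeZero (2 : ZMod p)] {π : M1 p → M1 p}

theorem crossedHom_rho_s (h : Hol.IsCrossedHom unip π) : (π rho).s = 0 := by
  have h_s := congrArg (fun x => (π x).s) tau_mul_sigma
  simp only [h _ _, unip_apply, mul_s] at h_s
  linear_combination -h_s

theorem crossedHom_rho_t (h : Hol.IsCrossedHom unip π) : (π rho).t = -(π tau).s := by
  have h_t := congrArg (fun x => (π x).t) tau_mul_sigma
  simp only [h _ _, unip_apply, mul_s, mul_t] at h_t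
  simp only [rho_s, sigma_s, tau_s] at h_t
  linear_combination -h_t

theorem crossedHom_relations (h : Hol.IsCrossedHom unip π) :
    (π sigma).s * (1 - (π tau).s) = 0 ∧ (π tau).s * (2 - (π tau).s) = 0 := by
  have h_sigma := congrArg (fun x => (π x).r) sigma_mul_rho
  have h_tau := congrArg (fun x => (π x).r) tau_mul_rho
  simp only [h _ _, unip_apply, mul_r, crossedHom_rho_s h, crossedHom_rho_t h] at h_sigma h_tau
  simp only [rho_r, rho_s, rho_t, sigma_r, sigma_s, sigma_t, tau_r, tau_s, tau_t] at h_sigma h_tau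
  exact ⟨by linear_combination -h_sigma, by linear_combination -h_tau⟩

theorem exists_s_ne_zero (h : Hol.IsCrossedHom unip π) (hπ : Function.Surjective π) :
    (π sigma).s ≠ 0 ∨ (π tau).s ≠ 0 := by
  by_contra! h_zero
  let χ : M1 p →* Multiplicative (ZMod p) :=
    { toFun u := Multiplicative.ofAdd (π u).s
      map_one' := by rw [h.map_one]; rfl
      map_mul' u v := by rw [h u v]; rfl }
  have χ_eq_one : χ = 1 :=
    monoidHom_ext (crossedHom_rho_s h) h_zero.1 h_zero.2
  obtain ⟨u, hu⟩ := hπ sigma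
  have one_eq_zero : (1 : ZMod p) = 0 :=
    (congrArg M1.s hu).symm.trans (DFunLike.congr_fun χ_eq_one u)
  exact one_ne_zero one_eq_zero

theorem crossedHom_s (h : Hol.IsCrossedHom unip π) (hπ : Function.Surjective π) :
    (π sigma).s = 0 ∧ (π tau).s = 2 := by
  obtain ⟨h_sigma, h_tau⟩ := crossedHom_relations h
  rcases mul_eq_zero.mp h_tau with tau_s | tau_s
  · rw [tau_s, sub_zero, mul_one] at h_sigma
    exact absurd (exists_s_ne_zero h hπ) (by simp [h_sigma, tau_s])
  · refine ⟨?_, by linear_combination -tau_s⟩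
    linear_combination -h_sigma + (π sigma).s * tau_s

theorem crossedHom_sigma_t (h : Hol.IsCrossedHom unip π) (hπ : Function.Surjective π) :
    (π sigma).t = 1 - (π rho).r := by
  have h2 := two_ne_zero (α := ZMod p)
  obtain ⟨πsigma_s, πtau_s⟩ := crossedHom_s h hπ
  have h_r := congrArg (fun x => (π x).r) tau_mul_sigma
  simp only [h _ _, unip_apply, mul_r, mul_s, mul_t, crossedHom_rho_t h, πsigma_s, πtau_s,
    rho_r, rho_s, rho_t, sigma_r, sigma_s, sigma_t, tau_r, tau_s, tau_t] at h_r
  field_simp at h_r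
  exact mul_left_cancel₀ h2 (by linear_combination -h_r)

theorem exists_conj_eq_cocycle (h : Hol.IsCrossedHom unip π) (hπ : Function.Surjective π) :
    ∃ (v : M1 p) (s t : ZMod p), ∀ u, unip v (π u) = cocycle s t (MulAut.conj v u) := by
  have h2 := two_ne_zero (α := ZMod p)
  let m := (π rho).r / 2
  let v : M1 p := ⟨-((π tau).r + m * (π tau).t) / 2, 0, m⟩
  let π' : M1 p → M1 p := fun u => unip v (π (v⁻¹ * u * v))
  have h' : Hol.IsCrossedHom unip π' := h.conj v
  have π'_conj (u : M1 p) : unip v (π u) = π' (MulAut.conj v u) := by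
    simp only [π', MulAut.conj_apply]
    group
  have hπ' : Function.Surjective π' := fun x => by
    obtain ⟨u, hu⟩ := hπ ((unip v).symm x)
    exact ⟨MulAut.conj v u, by rw [← π'_conj, hu, MulEquiv.apply_symm_apply]⟩
  obtain ⟨sigma_s, tau_s⟩ := crossedHom_s h' hπ'
  have conj_rho : v⁻¹ * rho * v = rho := by ext <;> simp [v]
  have conj_tau : v⁻¹ * tau * v = tau := by ext <;> simp [v]
  have π'_rho_r : (π' rho).r = 0 := by
    simp only [π', conj_rho, unip_apply, crossedHom_rho_s h, crossedHom_rho_t h,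
      (crossedHom_s h hπ).2, v, m]
    field_simp
    ring
  have π'_tau_r : (π' tau).r = 0 := by
    simp only [π', conj_tau, unip_apply, (crossedHom_s h hπ).2, v, m]
    field_simp
    ring
  have π'_eq : π' = cocycle (π' sigma).r (π' tau).t := by
    refine isCrossedHom_ext h' (isCrossedHom_cocycle _ _) ?_ ?_ ?_
    · rw [cocycle_rho]
      exact M1.ext π'_rho_r (crossedHom_rho_s h') (tau_s ▸ crossedHom_rho_t h')
    · rw [cocycle_sigma]
      exact M1.ext rfl sigma_s (by rw [crossedHom_sigma_t h' hπ', π'_rho_r, sub_zero])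
    · rw [cocycle_tau]
      exact M1.ext π'_tau_r tau_s rfl
  exact ⟨v, _, _, fun u => (π'_conj u).trans (congrFun π'_eq _)⟩

end NormalForm

section Rescaling

variable [Fact p.Prime] [NeZero (2 : ZMod p)]

theorem exists_rescale_cocycle {a d : ZMod p} (ha : a ≠ 0) (hd : d ≠ 0) (s t : ZMod p) :
    ∃ θ ω : MulAut (M1 p),
      ∀ u, θ (cocycle s t u) = cocycle (a ^ 2 * s) (d / a * t) (ω u) := by
  have h2 := two_ne_zero (α := ZMod p)
  have det_θ : a * d - 0 * 0 ≠ 0 := by simp [ha, hd]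
  have det_ω : d / a * a - 0 * 0 ≠ 0 := by simp [ha, hd]
  refine ⟨linAut det_θ * unip ⟨3 / 2 * t * (a - 1) / (2 * a), 0, 0⟩,
    unip ⟨(1 - a) / 2, 0, 0⟩ * linAut det_ω, fun u => ?_⟩
  simp only [MulAut.mul_apply, linAut_apply, linHom_apply, unip_apply, cocycle]
  ext <;> field_simp <;> ring

theorem exists_chart_cocycle {B : Type*} [SkewBrace B] (φ : Multiplicative B ≃* M1 p)
    (hker : Nat.card (SkewBrace.lam B).ker = 1) :
    ∃ s t : ZMod p, s ≠ 0 ∧ Nonempty (SkewBrace.Chart B (cocycle s t)) := by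
  obtain ⟨π, hπ, ⟨c⟩⟩ := exists_chart φ hker
  obtain ⟨v, s, t, h⟩ := exists_conj_eq_cocycle hπ c.bijective.surjective
  let c' : SkewBrace.Chart B (cocycle s t) := c.trans (unip v) (MulAut.conj v) h
  exact ⟨s, t, ne_zero_of_cocycle_injective c'.bijective.injective, ⟨c'⟩⟩

theorem exists_chart_normalized {B : Type*} [SkewBrace B] {δ : ZMod p} (hδ : ¬IsSquare δ)
    (φ : Multiplicative B ≃* M1 p) (hker : Nat.card (SkewBrace.lam B).ker = 1) :
    ∃ s t : ZMod p, (s = 1 ∨ s = δ) ∧ (t = 0 ∨ t = 1) ∧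
      Nonempty (SkewBrace.Chart B (cocycle s t)) := by
  obtain ⟨s, t, hs, ⟨c⟩⟩ := exists_chart_cocycle φ hker
  obtain ⟨a, ha, h_sq⟩ := exists_sq_mul_eq hδ hs
  obtain ⟨d, hd, h_t⟩ : ∃ d : ZMod p, d ≠ 0 ∧ (d / a * t = 0 ∨ d / a * t = 1) := by
    by_cases ht : t = 0
    · exact ⟨1, one_ne_zero, Or.inl (by rw [ht, mul_zero])⟩
    · exact ⟨a / t, div_ne_zero ha ht, Or.inr (by field_simp)⟩
  obtain ⟨θ, ω, h⟩ := exists_rescale_cocycle ha hd s t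
  exact ⟨_, _, h_sq, h_t, ⟨c.trans θ ω h⟩⟩

end Rescaling

section Uniqueness

variable [Fact p.Prime]

theorem det_ne_zero (θ : MulAut (M1 p)) :
    (θ sigma).s * (θ tau).t - (θ sigma).t * (θ tau).s ≠ 0 := by
  intro h
  have θ_rho : θ rho = θ 1 := by
    rw [map_rho, h, map_one]
    rfl
  exact one_ne_zero (congrArg M1.r (θ.injective θ_rho))

variable [NeZero (2 : ZMod p)] {θ ω : MulAut (M1 p)}

theorem intertwiner_tau_s (h : ∀ u x, θ (unip u x) = unip (ω u) (θ x)) : (θ tau).s = 0 := by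
  have h_r := congrArg M1.r (h rho tau)
  have unip_rho_tau : unip rho tau = (tau : M1 p) := unip_tau_right rho
  rw [unip_rho_tau, unip_apply, map_rho ω] at h_r
  refine (mul_eq_zero.mp ?_).resolve_left (det_ne_zero ω)
  linear_combination -h_r

theorem intertwiner_diagonal (h : ∀ u x, θ (unip u x) = unip (ω u) (θ x)) :
    (θ sigma).s ≠ 0 ∧ (θ tau).t ≠ 0 := by
  have h_det := det_ne_zero θ
  rw [intertwiner_tau_s h, mul_zero, sub_zero] at h_det
  exact mul_ne_zero_iff.mp h_det

theorem intertwiner_apply_s (h : ∀ u x, θ (unip u x) = unip (ω u) (θ x)) (u : M1 p) :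
    (ω u).s * (θ sigma).s = u.s * (θ tau).t := by
  have h_t := congrArg M1.t (h u sigma)
  rw [unip_sigma_right, unip_apply, map_t] at h_t
  linear_combination -h_t

theorem intertwiner_apply_t (h : ∀ u x, θ (unip u x) = unip (ω u) (θ x)) (u : M1 p) :
    (ω u).t = u.t * (θ sigma).s := by
  have θtau_s := intertwiner_tau_s h
  have h_r := congrArg M1.r (h u tau)
  rw [unip_tau_right, unip_apply, map_r_of_s_eq_zero θ θtau_s rfl, map_rho, θtau_s] at h_r
  refine mul_right_cancel₀ (intertwiner_diagonal h).2 ?_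
  linear_combination -h_r

theorem intertwiner_tau_r (h : ∀ u x, θ (unip u x) = unip (ω u) (θ x)) :
    (ω tau).r = -(θ sigma).t := by
  have ωtau_s : (ω tau).s = 0 := by
    refine (mul_eq_zero.mp ?_).resolve_right (intertwiner_diagonal h).1
    rw [intertwiner_apply_s h, tau_s, zero_mul]
  have h_r := congrArg M1.r (h tau sigma)
  have unip_tau_sigma : unip tau sigma = (sigma : M1 p) := unip_sigma_right tau
  rw [unip_tau_sigma, unip_apply, ωtau_s, intertwiner_apply_t h, tau_t] at h_r
  refine mul_right_cancel₀ (intertwiner_diagonal h).1 ?_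
  linear_combination -h_r

theorem rescale_of_intertwiner (h : ∀ u x, θ (unip u x) = unip (ω u) (θ x)) {s t s' t' : ZMod p}
    (hθ : ∀ u, θ (cocycle s t u) = cocycle s' t' (ω u)) :
    s' = (θ sigma).s ^ 2 * s ∧ t' * (θ sigma).s = (θ tau).t * t := by
  have h2 := two_ne_zero (α := ZMod p)
  have θtau_s := intertwiner_tau_s h
  obtain ⟨ha, hd⟩ := intertwiner_diagonal h
  have θtau_r : (θ tau).r = 0 := by
    have h_rho := congrArg M1.r (hθ rho)
    rw [cocycle_rho, map_r_of_s_eq_zero θ θtau_s rfl, map_rho ω] at h_rho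
    refine mul_left_cancel₀ h2 ?_
    simp only [cocycle] at h_rho
    linear_combination -h_rho
  have h_sigma := congrArg M1.r (hθ sigma)
  have h_tau := congrArg M1.t (hθ tau)
  have ωsigma_s := intertwiner_apply_s h sigma
  have ωtau_s := intertwiner_apply_s h tau
  rw [cocycle_sigma, map_r_of_s_eq_zero θ θtau_s rfl, map_rho θ, θtau_s, θtau_r] at h_sigma
  rw [cocycle_tau, map_t] at h_tau
  simp only [cocycle, intertwiner_apply_t h, intertwiner_tau_r h, sigma_s, sigma_t, tau_s, tau_t,
    zero_mul, one_mul, mul_eq_zero, ha, or_false] at h_sigma h_tau ωsigma_s ωtau_s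
  rw [ωtau_s] at h_tau
  constructor
  · refine mul_right_cancel₀ hd ?_
    linear_combination -(θ sigma).s * h_sigma - s' * ωsigma_s
  · linear_combination -h_tau

theorem cocycle_parameters_unique {B : Type*} [SkewBrace B] {δ : ZMod p} (hδ : ¬IsSquare δ)
    {s t s' t' : ZMod p} (hs : s = 1 ∨ s = δ) (ht : t = 0 ∨ t = 1) (hs' : s' = 1 ∨ s' = δ)
    (ht' : t' = 0 ∨ t' = 1) (c : SkewBrace.Chart B (cocycle s t))
    (c' : SkewBrace.Chart B (cocycle s' t')) : s = s' ∧ t = t' := by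
  obtain ⟨θ, ω, hθ⟩ := c.exists_intertwiner c'
  have h := (isCrossedHom_cocycle s t).intertwine (isCrossedHom_cocycle s' t')
    c.bijective.surjective θ ω hθ
  obtain ⟨h_s, h_t⟩ := rescale_of_intertwiner h hθ
  obtain ⟨ha, hd⟩ := intertwiner_diagonal h
  exact eq_and_eq_of_rescale hδ ha hd hs ht hs' ht' h_s h_t

end Uniqueness

section RegularSubgroups

variable [Fact p.Prime] [NeZero (2 : ZMod p)]

/-- The group of all `π u Λ_u` in the holomorph, where `π = cocycle s t` and `Λ = unip`. It is the
subgroup `H_{s,t}` of the holomorph, generated by the images of `ρ`, `σ` and `τ`. -/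
def regularSubgroup (s t : ZMod p) : Subgroup (Hol (M1 p)) :=
  (isCrossedHom_cocycle s t).toHom.range

theorem isRegular_regularSubgroup {s : ZMod p} (hs : s ≠ 0) (t : ZMod p) :
    Hol.IsRegular (regularSubgroup s t) :=
  (isCrossedHom_cocycle s t).isRegular_range (cocycle_bijective hs t)

/-- The coordinates `u ↦ π u Λ_u` on the skew brace of `regularSubgroup s t`. -/
noncomputable def regularSubgroupChart {s t : ZMod p} (hs : s ≠ 0)
    (h : Hol.IsRegular (regularSubgroup s t)) :
    SkewBrace.Chart (Hol.Brace (regularSubgroup s t) h) (cocycle s t) :=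
  Hol.Brace.chart (isCrossedHom_cocycle s t) (cocycle_injective hs t) h

theorem exists_isRegular_regularSubgroup {s : ZMod p} (hs : s ≠ 0) (t : ZMod p) :
    ∃ h : Hol.IsRegular (regularSubgroup s t),
      SkewBrace.IsOfType (Hol.Brace _ h) (M1 p) ∧ Nonempty (Hol.Brace _ h ≃* M1 p) ∧
        Nat.card (SkewBrace.lam (Hol.Brace _ h)).ker = 1 := by
  have h := isRegular_regularSubgroup hs t
  let c := regularSubgroupChart hs h
  exact ⟨h, ⟨c.add⟩, ⟨c.mul.symm⟩, c.natCard_ker_lam (isCrossedHom_cocycle s t) unip_injective⟩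

theorem existsUnique_regularSubgroup {B : Type*} [SkewBrace B] (φ : Multiplicative B ≃* M1 p)
    (hker : Nat.card (SkewBrace.lam B).ker = 1) {δ : ZMod p} (hδ : ¬IsSquare δ) :
    ∃! st : ZMod p × ZMod p, (st.1 = 1 ∨ st.1 = δ) ∧ (st.2 = 0 ∨ st.2 = 1) ∧
      ∃ h : Hol.IsRegular (regularSubgroup st.1 st.2), Nonempty (B ≃+* Hol.Brace _ h) := by
  obtain ⟨s, t, hs, ht, ⟨c⟩⟩ := exists_chart_normalized hδ φ hker
  have hs₀ := ne_zero_of_cocycle_injective c.bijective.injective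
  have h := isRegular_regularSubgroup hs₀ t
  refine ⟨(s, t), ⟨hs, ht, h, ⟨c.equiv (regularSubgroupChart hs₀ h)⟩⟩, ?_⟩
  rintro ⟨s', t'⟩ ⟨hs', ht', h', ⟨e⟩⟩
  have c' := (regularSubgroupChart (ne_zero_of_eq_one_or_eq hδ hs') h').comap e
  obtain ⟨s_eq, t_eq⟩ := cocycle_parameters_unique hδ hs' ht' hs ht c' c
  exact Prod.ext s_eq t_eq

theorem regularSubgroup_eq_kerOneSubgroup (hp : 3 < p) :
    regularSubgroup = kerOneSubgroup hp := by
  funext s t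
  let f := (isCrossedHom_cocycle s t).toHom
  have f_rho : f rho = ⟨(tau ^ 2)⁻¹, alpha1⟩ := by
    refine SemidirectProduct.ext ((cocycle_rho s t).trans ?_) ?_
    · ext <;> simp [tau_pow]
    · ext x <;> simp [f, Hol.IsCrossedHom.toHom_apply, unip_apply, alpha1]
  have f_sigma : f sigma = ⟨rho ^ s.val * tau, alpha2 hp⟩ := by
    refine SemidirectProduct.ext ((cocycle_sigma s t).trans ?_) ?_
    · ext <;> simp [rho_pow]
    · ext x <;> simp [f, Hol.IsCrossedHom.toHom_apply, unip_apply, alpha2]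
  have f_tau : f tau = ⟨sigma ^ 2 * tau ^ t.val, alpha3⟩ := by
    refine SemidirectProduct.ext ((cocycle_tau s t).trans ?_) ?_
    · ext <;> simp [sigma_pow, tau_pow]
    · ext x <;> simp [f, Hol.IsCrossedHom.toHom_apply, unip_apply, alpha3]
  rw [regularSubgroup, MonoidHom.range_eq_map, ← closure_eq_top, MonoidHom.map_closure,
    kerOneSubgroup, Set.image_insert_eq, Set.image_insert_eq, Set.image_singleton]
  exact congrArg Subgroup.closure (by rw [f_rho, f_sigma, f_tau])

end RegularSubgroups

end M1

theorem mainTheorem7_general (p : ℕ) [Fact p.Prime] :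
    (∀ (B : Type*) [SkewBrace B] (φ : Multiplicative B ≃* M1 p),
      (¬ SkewBrace.IsTrivial B →
        Nat.card (SkewBrace.lam B).ker = p ^ 2 ∨
        Nat.card (SkewBrace.lam B).ker = p ∨
        Nat.card (SkewBrace.lam B).ker = 1) ∧
      (Nat.card (SkewBrace.lam B).ker = p ^ 2 ∨ Nat.card (SkewBrace.lam B).ker = p →
        SkewBrace.socle B = {b | φ (Multiplicative.ofAdd b) ∈ Subgroup.zpowers M1.rho} ∧
        SkewBrace.annihilator B = {b | φ (Multiplicative.ofAdd b) ∈ Subgroup.zpowers M1.rho} ∧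
        SkewBrace.socle B = (AddSubgroup.center B : Set B) ∧
        Subgroup.zpowers (M1.rho : M1 p) = Subgroup.center (M1 p)) ∧
      (Nat.card (SkewBrace.lam B).ker = 1 →
        SkewBrace.socle B = {0} ∧ SkewBrace.annihilator B = {0} ∧
        ∀ (A Q : Type*) [SkewBrace A] [SkewBrace Q] (i : A → B) (q : B → Q),
          SkewBrace.IsAnnihilatorExtension i q → Subsingleton A)) ∧
    (∀ [NeZero (2 : ZMod p)],
      (∀ s t : ZMod p, s ≠ 0 →
        ∃ h : Hol.IsRegular (M1.regularSubgroup s t),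
          SkewBrace.IsOfType (Hol.Brace _ h) (M1 p) ∧
          Nonempty (Hol.Brace _ h ≃* M1 p) ∧
          Nat.card (SkewBrace.lam (Hol.Brace _ h)).ker = 1) ∧
      (∀ δ : ZMod p, ¬ IsSquare δ →
        ∀ (B : Type*) [SkewBrace B], SkewBrace.IsOfType B (M1 p) →
        Nat.card (SkewBrace.lam B).ker = 1 →
        ∃! st : ZMod p × ZMod p, (st.1 = 1 ∨ st.1 = δ) ∧ (st.2 = 0 ∨ st.2 = 1) ∧
          ∃ h : Hol.IsRegular (M1.regularSubgroup st.1 st.2),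
            Nonempty (B ≃+* Hol.Brace _ h))) := by
  refine ⟨fun B _ φ => ?_, fun {_} =>
    ⟨fun s t hs => M1.exists_isRegular_regularSubgroup hs t,
      fun δ hδ B _ ⟨φ⟩ hker => M1.existsUnique_regularSubgroup φ hker hδ⟩⟩
  have card_B := M1.natCard_of_mulEquiv φ
  have card_center := M1.natCard_addCenter_of_mulEquiv φ
  refine ⟨SkewBrace.natCard_ker_lam_of_not_isTrivial card_B, fun hker => ?_, fun hker => ?_⟩
  · have socle_eq := SkewBrace.socle_eq_center card_B card_center hker
    rw [← M1.addCenter_eq_preimage_zpowers_rho φ]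
    exact ⟨socle_eq, SkewBrace.annihilator_eq_center card_B card_center hker, socle_eq,
      M1.zpowers_rho_eq_center⟩
  · have annihilator_eq := SkewBrace.annihilator_eq_singleton_zero hker
    exact ⟨SkewBrace.socle_eq_singleton_zero hker, annihilator_eq,
      fun A Q _ _ i q h => h.subsingleton_left annihilator_eq⟩

theorem mainTheorem7 (p : ℕ) [Fact p.Prime] (hp : 3 < p) :
    -- socle and annihilator of an arbitrary skew brace `B` of `M₁` type
    (∀ (B : Type*) [SkewBrace B] (φ : Multiplicative B ≃* M1 p),
      (¬ SkewBrace.IsTrivial B →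
        Nat.card (SkewBrace.lam B).ker = p ^ 2 ∨
        Nat.card (SkewBrace.lam B).ker = p ∨
        Nat.card (SkewBrace.lam B).ker = 1) ∧
      (Nat.card (SkewBrace.lam B).ker = p ^ 2 ∨ Nat.card (SkewBrace.lam B).ker = p →
        SkewBrace.socle B = {b | φ (Multiplicative.ofAdd b) ∈ Subgroup.zpowers M1.rho} ∧
        SkewBrace.annihilator B = {b | φ (Multiplicative.ofAdd b) ∈ Subgroup.zpowers M1.rho} ∧
        SkewBrace.socle B = (AddSubgroup.center B : Set B) ∧
        Subgroup.zpowers (M1.rho : M1 p) = Subgroup.center (M1 p)) ∧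
      (Nat.card (SkewBrace.lam B).ker = 1 →
        SkewBrace.socle B = {0} ∧ SkewBrace.annihilator B = {0} ∧
        -- `B` is not an annihilator extension with non-zero kernel
        ∀ (A Q : Type*) [SkewBrace A] [SkewBrace Q] (i : A → B) (q : B → Q),
          SkewBrace.IsAnnihilatorExtension i q → Subsingleton A)) ∧
    -- the skew braces of `M₁` type with `|ker λ| = 1` are exactly four up to isomorphism
    (∀ δ : ZMod p, ¬ IsSquare δ →
      (∀ s t : ZMod p, s = 1 ∨ s = δ → t = 0 ∨ t = 1 →
        ∃ h : Hol.IsRegular (M1.kerOneSubgroup hp s t),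
          SkewBrace.IsOfType (Hol.Brace _ h) (M1 p) ∧
          Nonempty (Hol.Brace _ h ≃* M1 p) ∧
          Nat.card (SkewBrace.lam (Hol.Brace _ h)).ker = 1) ∧
      (∀ (B : Type*) [SkewBrace B], SkewBrace.IsOfType B (M1 p) →
        Nat.card (SkewBrace.lam B).ker = 1 →
        ∃! st : ZMod p × ZMod p, (st.1 = 1 ∨ st.1 = δ) ∧ (st.2 = 0 ∨ st.2 = 1) ∧
          ∃ h : Hol.IsRegular (M1.kerOneSubgroup hp st.1 st.2),
            Nonempty (B ≃+* Hol.Brace _ h))) := by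
  have := M1.neZero_two hp
  have general := mainTheorem7_general p
  rw [← M1.regularSubgroup_eq_kerOneSubgroup hp]
  exact ⟨general.1, fun δ hδ => ⟨fun s t hs _ =>
    general.2.1 s t (ne_zero_of_eq_one_or_eq hδ hs), general.2.2 δ hδ⟩⟩
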